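/- Let $n\ge 1$. Let $\hat{\mathfrak S}_n$ be the group of bijections $\sigma:\mathbf Z\to\mathbf Z$ with $\sigma(n+r)=n+\sigma(r)$ for all $r$, let $c\in\hat{\mathfrak S}_n$ be $r\mapsto r+1$ and, if $n\ge 2$, for $a\in\mathbf Z/n$ let $s_a\in\hat{\mathfrak S}_n$ be the element with $s_a(r)=r+1$ for $r\in a$, $s_a(r)=r-1$ for $r\in a+1$, and $s_a(r)=r$ otherwise. Every $\sigma\in\hat{\mathfrak S}_n$ can be written $\sigma=s_{a_1}\cdots s_{a_l}c^d$ with $d\in\mathbf Z$ (for $n=1$ there are no $s_a$, and $l=0$); the expression is reduced if $l$ is minimal. Let $\hat{\mathfrak S}_n^+$ be the submonoid of those $\sigma$ with $\sigma(\mathbf Z_{>0})\subset\mathbf Z_{>0}$. Let $\hat H_n$ be the differential graded $\mathbf F_2$-algebra generated by $c^{\pm1}$ and, if $n\ge 2$, by $T_a$ for $a\in\mathbf Z/n$, with relations $$T_a^2=0,\quad cT_a=T_{a+1}c,\quad T_aT_b=T_bT_a\text{ if }a\ne b\pm1,\quad T_aT_{a+1}T_a=T_{a+1}T_aT_{a+1}\text{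 if }n>2,$$ with $T_a$ in degree $-1$, $c$ in degree $0$, and differential given by $d(T_a)=1$, $d(c)=0$. For $\sigma\in\hat{\mathfrak S}_n$ with a reduced expression $\sigma=s_{a_1}\cdots s_{a_l}c^d$ put $T_\sigma=T_{a_1}\cdots T_{a_l}c^d$ (this does not depend on the reduced expression), and let $\hat H_n^+\subset\hat H_n$ be the $\mathbf F_2$-span of the $T_\sigma$ with $\sigma\in\hat{\mathfrak S}_n^+$. Then $\hat H_n^+$ is a differential graded subalgebra of $\hat H_n$. Moreover, the algebra $\hat H_n^+$ has a presentation with generators $T_1,\ldots,T_{n-1},c$ (where $T_i$ is $T_{i+n\mathbf Z}$) and relations $$T_i^2=0,\quad T_iT_j=T_jT_i\text{ if }|i-j|>1,\quad T_iT_{i+1}T_i=T_{i+1}T_iT_{i+1}\text{ for }1\le i<n-1,$$ $$cT_i=T_{i+1}c\text{ for }1\le i<n-1,\quad\text{and}\quad c^2T_{n-1}=T_1c^2\text{ if }n\ge 2.$$ -/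

import Mathlib

namespace ExtAffine

/-! ### The extended affine symmetric group -/

/-- The extended affine symmetric group: the bijections `σ` of `ℤ` with `σ (n + r) = n + σ r`,
a subgroup of the group of permutations of `ℤ`. -/
def affPerm (n : ℕ) : Subgroup (Equiv.Perm ℤ) where
  carrier := {σ | ∀ r : ℤ, σ (n + r) = n + σ r}
  one_mem' := fun _ => rfl
  mul_mem' := by
    intro σ τ hσ hτ r
    simp only [Set.mem_ofPred_eq] at hσ hτ
    simp [Equiv.Perm.mul_apply, hσ, hτ]
  inv_mem' := by
    intro σ hσ r
    simp only [Set.mem_ofPred_eq] at hσ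
    rw [Equiv.Perm.inv_eq_iff_eq, hσ]
    simp

/-- The positive submonoid: the `σ` that map positive integers to positive integers. -/
def posAffPerm (n : ℕ) : Submonoid (affPerm n) where
  carrier := {σ | ∀ r : ℤ, 0 < r → 0 < (σ : Equiv.Perm ℤ) r}
  one_mem' := fun _ hr => hr
  mul_mem' := fun hσ hτ r hr => hσ _ (hτ r hr)

/-- The index set `ℤ/n` of the simple reflections of type `Â_{n-1}`. For `n = 1` the affine Weyl
group is trivial and there is no simple reflection; accordingly the type is empty for `n < 2`. -/
abbrev Node (n : ℕ) : Type := {_a : ZMod n // 2 ≤ n}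

/-- The rotation `a ↦ a + 1` of the nodes. -/
def Node.succ {n : ℕ} (a : Node n) : Node n := ⟨a.1 + 1, a.2⟩

theorem one_ne_zero_zmod {n : ℕ} (h : 2 ≤ n) : (1 : ZMod n) ≠ 0 := by
  have : Fact (1 < n) := ⟨h⟩
  exact one_ne_zero

/-- The map `s_{i,i+1}`, `a = i + nℤ`: it exchanges `r` and `r + 1` for every `r ∈ a`. -/
def simpleFun {n : ℕ} (a : Node n) (r : ℤ) : ℤ :=
  if (r : ZMod n) = a.1 then r + 1 else if (r : ZMod n) = a.1 + 1 then r - 1 else r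

theorem simpleFun_invol {n : ℕ} (a : Node n) : Function.Involutive (simpleFun a) := by
  intro r
  have h1 := one_ne_zero_zmod a.2
  unfold simpleFun
  by_cases h : (r : ZMod n) = a.1
  · simp [h, h1]
  · by_cases h' : (r : ZMod n) = a.1 + 1
    · simp [h', h1]
    · simp [h, h']

/-- The simple reflection `s_a` as an element of the extended affine symmetric group. -/
def simple {n : ℕ} (a : Node n) : affPerm n :=
  ⟨(simpleFun_invol a).toPerm, by
    intro r
    simp only [Function.Involutive.coe_toPerm, simpleFun]
    push_cast
    simp only [ZMod.natCast_self, zero_add]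
    split_ifs <;> ring⟩

/-- The element `c : r ↦ r + 1`. -/
def rot (n : ℕ) : affPerm n :=
  ⟨Equiv.addRight 1, by intro r; simp [add_assoc]⟩

theorem simple_apply {n : ℕ} (a : Node n) (r : ℤ) :
    (simple a : Equiv.Perm ℤ) r = simpleFun a r := rfl

theorem simple_mul_self {n : ℕ} (a : Node n) : simple a * simple a = 1 := by
  apply Subtype.ext
  ext r
  exact simpleFun_invol a r

theorem rot_zpow_apply (n : ℕ) (d r : ℤ) : ((rot n ^ d : affPerm n) : Equiv.Perm ℤ) r = r + d := by
  rw [Subgroup.coe_zpow]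
  simp [rot]

/-- `IsExpr σ w d`: the word `w = (a₁, …, a_l)` and the integer `d` satisfy
`σ = s_{a₁} ⋯ s_{a_l} c ^ d`. -/
def IsExpr {n : ℕ} (σ : affPerm n) (w : List (Node n)) (d : ℤ) : Prop :=
  σ = (w.map simple).prod * rot n ^ d

/-! Every element has such an expression. -/

/-- A sum of squares that drops when a descent of `σ` is sorted. -/
def energy {n : ℕ} (σ : affPerm n) (i : ℤ) : ℤ :=
  ∑ r ∈ Finset.range n, ((σ : Equiv.Perm ℤ) (i + r) - (i + r)) ^ 2

theorem energy_succ {n : ℕ} (σ : affPerm n) (i : ℤ) : energy σ (i + 1) = energy σ i := by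
  cases n with
  | zero => simp [energy]
  | succ m =>
    unfold energy
    rw [Finset.sum_range_succ, Finset.sum_range_succ']
    congr 1
    · apply Finset.sum_congr rfl
      intro r _
      push_cast
      rw [show i + 1 + (r : ℤ) = i + (r + 1) by ring]
    · have h := σ.2 i
      rw [show i + 1 + (m : ℤ) = ((m + 1 : ℕ) : ℤ) + i by push_cast; ring, h]
      push_cast
      ring_nf

theorem energy_const {n : ℕ} (σ : affPerm n) (i : ℤ) : energy σ i = energy σ 0 := by
  induction i using Int.induction_on with
  | zero => rfl
  | succ i ih => rw [energy_succ, ih]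
  | pred i ih => rw [← energy_succ, sub_add_cancel, ih]

theorem energy_mul_simple {n : ℕ} (h2 : 2 ≤ n) (σ : affPerm n) (i : ℤ)
    (hi : (σ : Equiv.Perm ℤ) (i + 1) < (σ : Equiv.Perm ℤ) i) :
    energy (σ * simple ⟨(i : ZMod n), h2⟩) 0 < energy σ 0 := by
  rw [← energy_const _ i, ← energy_const σ i]
  obtain ⟨m, rfl⟩ : ∃ m, n = m + 2 := ⟨n - 2, by omega⟩
  unfold energy
  simp only [Subgroup.coe_mul, Equiv.Perm.mul_apply, simple_apply]
  rw [Finset.sum_range_succ', Finset.sum_range_succ', Finset.sum_range_succ' _ (m + 1),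
    Finset.sum_range_succ' _ m, add_assoc, add_assoc]
  apply add_lt_add_of_le_of_lt
  · apply le_of_eq
    apply Finset.sum_congr rfl
    intro r hr
    have hr := Finset.mem_range.mp hr
    have e : simpleFun (n := m + 2) ⟨(i : ZMod (m + 2)), h2⟩ (i + ((r + 1 + 1 : ℕ) : ℤ))
        = i + ((r + 1 + 1 : ℕ) : ℤ) := by
      have k1 : ((r + 1 + 1 : ℕ) : ZMod (m + 2)) ≠ 0 := by
        rw [Ne, ZMod.natCast_eq_zero_iff]
        intro hd
        have := Nat.le_of_dvd (by omega) hd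
        omega
      have k2 : ((r + 1 : ℕ) : ZMod (m + 2)) ≠ 0 := by
        rw [Ne, ZMod.natCast_eq_zero_iff]
        intro hd
        have := Nat.le_of_dvd (by omega) hd
        omega
      unfold simpleFun
      rw [if_neg, if_neg]
      · intro hh
        apply k2
        push_cast at hh ⊢
        linear_combination hh
      · intro hh
        apply k1
        push_cast at hh ⊢
        linear_combination hh
    rw [e]
  · have e0 : simpleFun (n := m + 2) ⟨(i : ZMod (m + 2)), h2⟩ i = i + 1 := by
      simp [simpleFun]
    have e1 : simpleFun (n := m + 2) ⟨(i : ZMod (m + 2)), h2⟩ (i + 1) = i := by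
      have := one_ne_zero_zmod h2
      simp [simpleFun, this]
    simp only [zero_add, Nat.cast_one, Nat.cast_zero, add_zero, e0, e1]
    nlinarith

theorem eq_rot_of_forall_lt {n : ℕ} (σ : affPerm n)
    (h : ∀ i, (σ : Equiv.Perm ℤ) i < (σ : Equiv.Perm ℤ) (i + 1)) : ∃ d : ℤ, σ = rot n ^ d := by
  have hm : StrictMono (σ : Equiv.Perm ℤ) := strictMono_int_of_lt_succ h
  have hs : ∀ i, (σ : Equiv.Perm ℤ) (i + 1) = (σ : Equiv.Perm ℤ) i + 1 := by
    intro i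
    obtain ⟨j, hj⟩ := (σ : Equiv.Perm ℤ).surjective ((σ : Equiv.Perm ℤ) i + 1)
    have hij : i < j := hm.lt_iff_lt.mp (by omega)
    have := hm.monotone (show i + 1 ≤ j by omega)
    have := h i
    omega
  refine ⟨(σ : Equiv.Perm ℤ) 0, ?_⟩
  apply Subtype.ext
  ext r
  rw [rot_zpow_apply]
  induction r using Int.induction_on with
  | zero => simp
  | succ i ih => rw [hs, ih]; ring
  | pred i ih =>
    have := hs (-(i : ℤ) - 1)
    rw [sub_add_cancel] at this
    omega

theorem exists_right_expr {n : ℕ} [NeZero n] (k : ℕ) : ∀ σ : affPerm n, (energy σ 0).toNat ≤ k →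
    ∃ (w : List (Node n)) (d : ℤ), σ = rot n ^ d * (w.map simple).prod := by
  induction k using Nat.strong_induction_on with
  | _ k ih =>
    intro σ hσ
    by_cases h : ∀ i, (σ : Equiv.Perm ℤ) i < (σ : Equiv.Perm ℤ) (i + 1)
    · obtain ⟨d, hd⟩ := eq_rot_of_forall_lt σ h
      exact ⟨[], d, by simpa using hd⟩
    · push Not at h
      obtain ⟨i, hi⟩ := h
      have hne : (σ : Equiv.Perm ℤ) (i + 1) ≠ (σ : Equiv.Perm ℤ) i := by
        intro he
        have := (σ : Equiv.Perm ℤ).injective he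
        omega
      have hlt := lt_of_le_of_ne hi hne
      have h2 : 2 ≤ n := by
        by_contra hn
        have h0 := NeZero.ne n
        obtain rfl : n = 1 := by omega
        have := σ.2 i
        rw [add_comm] at this
        push_cast at this
        omega
      have hE := energy_mul_simple h2 σ i hlt
      have hpos : 0 ≤ energy (σ * simple ⟨(i : ZMod n), h2⟩) 0 :=
        Finset.sum_nonneg fun _ _ => sq_nonneg _
      obtain ⟨w, d, hw⟩ := ih _ (by omega : (energy (σ * simple ⟨(i : ZMod n), h2⟩) 0).toNat < k)
        (σ * simple ⟨(i : ZMod n), h2⟩) le_rfl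
      refine ⟨w ++ [⟨(i : ZMod n), h2⟩], d, ?_⟩
      rw [List.map_append, List.prod_append, ← mul_assoc, ← hw]
      simp [mul_assoc, simple_mul_self]

theorem exists_isExpr {n : ℕ} [NeZero n] (σ : affPerm n) :
    ∃ (l : ℕ) (w : List (Node n)) (d : ℤ), w.length = l ∧ IsExpr σ w d := by
  obtain ⟨w, d, h⟩ := exists_right_expr _ σ⁻¹ le_rfl
  refine ⟨_, w.reverse, -d, rfl, ?_⟩
  have hs : ∀ a : Node n, (simple a)⁻¹ = simple a := fun a =>
    inv_eq_of_mul_eq_one_left (simple_mul_self a)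
  unfold IsExpr
  rw [← inv_inv σ, h, mul_inv_rev, List.prod_inv_reverse, List.map_map, List.map_reverse, zpow_neg]
  congr 4

open Classical in
/-- The length of `σ = w c ^ d`, with `w` in the subgroup generated by the `s_a` (the affine Weyl
group) and `d ∈ ℤ`: the Coxeter length of `w`, that is, the least length of an expression
of `w` as a product of simple reflections. -/
noncomputable def length {n : ℕ} [NeZero n] (σ : affPerm n) : ℕ := Nat.find (exists_isExpr σ)

theorem exists_reduced {n : ℕ} [NeZero n] (σ : affPerm n) :
    ∃ p : List (Node n) × ℤ, p.1.length = length σ ∧ IsExpr σ p.1 p.2 := by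
  classical
  obtain ⟨w, d, h⟩ := Nat.find_spec (exists_isExpr σ)
  exact ⟨(w, d), h⟩

/-- A reduced expression `σ = s_{a₁} ⋯ s_{a_l} c ^ d`, `l = ℓ(σ)`. -/
noncomputable def reducedExpr {n : ℕ} [NeZero n] (σ : affPerm n) : List (Node n) × ℤ :=
  (exists_reduced σ).choose

/-! ### The extended affine nil Hecke algebra -/

/-- Generators of the extended affine nil Hecke algebra: the `T_a`, `c` and `c⁻¹`. -/
inductive Gen (n : ℕ) : Type
  | T (a : Node n)
  | c
  | cinv

open FreeAlgebra in
/-- Defining relations of the extended affine nil Hecke algebra. -/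
inductive Rel (n : ℕ) : FreeAlgebra (ZMod 2) (Gen n) → FreeAlgebra (ZMod 2) (Gen n) → Prop
  | c_cinv : Rel n (ι _ Gen.c * ι _ Gen.cinv) 1
  | cinv_c : Rel n (ι _ Gen.cinv * ι _ Gen.c) 1
  | sq (a : Node n) : Rel n (ι _ (Gen.T a) * ι _ (Gen.T a)) 0
  | c_T (a : Node n) : Rel n (ι _ Gen.c * ι _ (Gen.T a)) (ι _ (Gen.T a.succ) * ι _ Gen.c)
  | comm (a b : Node n) (h₁ : a.1 ≠ b.1 + 1) (h₂ : a.1 ≠ b.1 - 1) :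
      Rel n (ι _ (Gen.T a) * ι _ (Gen.T b)) (ι _ (Gen.T b) * ι _ (Gen.T a))
  | braid (a : Node n) (h : 2 < n) :
      Rel n (ι _ (Gen.T a) * ι _ (Gen.T a.succ) * ι _ (Gen.T a))
        (ι _ (Gen.T a.succ) * ι _ (Gen.T a) * ι _ (Gen.T a.succ))

/-- The extended affine nil Hecke algebra `Ĥ_n` over `𝔽₂`. -/
abbrev Hhat (n : ℕ) : Type := RingQuot (Rel n)

/-- The class of a generator in `Ĥ_n`. -/
def gen {n : ℕ} (g : Gen n) : Hhat n := RingQuot.mkAlgHom (ZMod 2) (Rel n) (FreeAlgebra.ι _ g)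

/-- The generator `T_a` of `Ĥ_n`. -/
def T {n : ℕ} (a : Node n) : Hhat n := gen (Gen.T a)

/-- The generator `c` of `Ĥ_n`. -/
def c (n : ℕ) : Hhat n := gen Gen.c

theorem mk_rel {n : ℕ} {x y : FreeAlgebra (ZMod 2) (Gen n)} (h : Rel n x y) :
    RingQuot.mkAlgHom (ZMod 2) (Rel n) x = RingQuot.mkAlgHom (ZMod 2) (Rel n) y :=
  RingQuot.mkAlgHom_rel (ZMod 2) h

/-- `c` as a unit of `Ĥ_n`. -/
def cUnit (n : ℕ) : (Hhat n)ˣ where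
  val := c n
  inv := gen Gen.cinv
  val_inv := by simpa [c, gen] using mk_rel (Rel.c_cinv (n := n))
  inv_val := by simpa [c, gen] using mk_rel (Rel.cinv_c (n := n))

/-- The element `T_σ = T_{a₁} ⋯ T_{a_l} c ^ d` for a reduced expression
`σ = s_{a₁} ⋯ s_{a_l} c ^ d`; by the braid relations it does not depend on the chosen
reduced expression. -/
noncomputable def Tel {n : ℕ} [NeZero n] (σ : affPerm n) : Hhat n :=
  ((reducedExpr σ).1.map T).prod * ((cUnit n ^ (reducedExpr σ).2 : (Hhat n)ˣ) : Hhat n)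

/-- `Ĥ_n⁺`: the span of the `T_σ` for `σ` in the positive submonoid. -/
noncomputable def HhatPlus (n : ℕ) [NeZero n] : Submodule (ZMod 2) (Hhat n) :=
  Submodule.span (ZMod 2) {x | ∃ σ ∈ posAffPerm n, x = Tel σ}

/-! ### Differential graded algebras over `𝔽₂` -/

/-- A differential graded structure on an `𝔽₂`-algebra: a `ℤ`-grading and a differential of
degree `1` that satisfies the Leibniz rule (signs are invisible in characteristic two). -/
structure DGStructure (A : Type*) [Ring A] [Algebra (ZMod 2) A] where
  piece : ℤ → Submodule (ZMod 2) A
  [graded : GradedAlgebra piece]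
  d : A →ₗ[ZMod 2] A
  d_mem : ∀ k x, x ∈ piece k → d x ∈ piece (k + 1)
  d_mul : ∀ x y, d (x * y) = d x * y + x * d y
  d_d : ∀ x, d (d x) = 0

attribute [instance] DGStructure.graded

/-- A subalgebra is a differential graded subalgebra if it contains the homogeneous components
and the differentials of its elements. -/
def IsDGSubalgebra {A : Type*} [Ring A] [Algebra (ZMod 2) A] (D : DGStructure A)
    (S : Subalgebra (ZMod 2) A) : Prop :=
  (∀ x ∈ S, ∀ k : ℤ, (DirectSum.decompose D.piece x k : A) ∈ S) ∧ ∀ x ∈ S, D.d x ∈ S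

/-! ### The differential graded structure on `Ĥ_n` -/

/-- Two algebra homomorphisms out of `Ĥ_n` that agree on the generators are equal. -/
theorem Hhat.hom_ext {n : ℕ} {B : Type*} [Semiring B] [Algebra (ZMod 2) B]
    {f g : Hhat n →ₐ[ZMod 2] B} (h : ∀ x, f (gen x) = g (gen x)) : f = g := by
  apply RingQuot.ringQuot_ext'
  apply FreeAlgebra.hom_ext
  funext x
  exact h x

/-- Degrees of the generators: `T_a` has degree `-1`, `c` and `c⁻¹` have degree `0`. -/
def Gen.deg {n : ℕ} : Gen n → ℤ
  | .T _ => -1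
  | .c => 0
  | .cinv => 0

/-- The degree `k` part of `Ĥ_n`: the span of the monomials of degree `k` in the generators. -/
def piece (n : ℕ) (k : ℤ) : Submodule (ZMod 2) (Hhat n) :=
  Submodule.span (ZMod 2) {x | ∃ w : List (Gen n), (w.map Gen.deg).sum = k ∧ x = (w.map gen).prod}

theorem gen_mem {n : ℕ} (g : Gen n) : gen g ∈ piece n g.deg :=
  Submodule.subset_span ⟨[g], by simp, by simp⟩

instance pieceMonoid (n : ℕ) : SetLike.GradedMonoid (piece n) where
  one_mem := Submodule.subset_span ⟨[], by simp, by simp⟩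
  mul_mem := by
    intro i j x y hx hy
    have h := Submodule.mul_mem_mul hx hy
    rw [piece, piece, Submodule.span_mul_span] at h
    refine Submodule.span_mono ?_ h
    rintro _ ⟨_, ⟨w, rfl, rfl⟩, _, ⟨v, rfl, rfl⟩, rfl⟩
    exact ⟨w ++ v, by simp, by simp⟩

open DirectSum in
/-- The value on a generator of the decomposition homomorphism. -/
def decompGen {n : ℕ} (g : Gen n) : ⨁ k, piece n k := DirectSum.of _ g.deg ⟨gen g, gen_mem g⟩

open DirectSum in
theorem of_congr {n : ℕ} {i j : ℤ} (h : i = j) {x y : Hhat n} (hx : x ∈ piece n i)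
    (hy : y ∈ piece n j) (hxy : x = y) :
    DirectSum.of (fun k => piece n k) i ⟨x, hx⟩ = DirectSum.of (fun k => piece n k) j ⟨y, hy⟩ := by
  subst h; subst hxy; rfl

open DirectSum in
theorem of_eq_zero {n : ℕ} {i : ℤ} {x : Hhat n} (hx : x ∈ piece n i) (h : x = 0) :
    DirectSum.of (fun k => piece n k) i ⟨x, hx⟩ = 0 := by
  subst h
  exact map_zero _

open DirectSum in
/-- The decomposition of `Ĥ_n` into homogeneous components. -/
def decomp (n : ℕ) : Hhat n →ₐ[ZMod 2] ⨁ k, piece n k :=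
  RingQuot.liftAlgHom (ZMod 2) ⟨FreeAlgebra.lift (ZMod 2) decompGen, by
    intro x y h
    have hm := mk_rel h
    cases h <;> simp only [map_mul, map_one, map_zero, FreeAlgebra.lift_ι_apply, decompGen,
      DirectSum.of_mul_of] at hm ⊢
    · rw [DirectSum.one_def]
      exact of_congr (by simp [Gen.deg]) _ _ hm
    · rw [DirectSum.one_def]
      exact of_congr (by simp [Gen.deg]) _ _ hm
    · exact of_eq_zero _ hm
    · exact of_congr (by simp [Gen.deg]) _ _ hm
    · exact of_congr (by simp [Gen.deg]) _ _ hm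
    · exact of_congr (by simp [Gen.deg]) _ _ hm⟩

open DirectSum in
theorem decomp_gen {n : ℕ} (g : Gen n) : decomp n (gen g) = decompGen g := by
  simp [decomp, gen, RingQuot.liftAlgHom_mkAlgHom_apply]

open DirectSum in
theorem decomp_monomial {n : ℕ} (w : List (Gen n))
    (h : (w.map gen).prod ∈ piece n (w.map Gen.deg).sum) :
    decomp n (w.map gen).prod = DirectSum.of (fun k => piece n k) _ ⟨_, h⟩ := by
  induction w with
  | nil =>
    simp only [List.map_nil, List.prod_nil, map_one]
    rw [DirectSum.one_def]
    exact of_congr (by simp) _ _ rfl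
  | cons g w ih =>
    have hw : (w.map gen).prod ∈ piece n (w.map Gen.deg).sum :=
      Submodule.subset_span ⟨w, rfl, rfl⟩
    simp only [List.map_cons, List.prod_cons, map_mul]
    rw [ih hw, decomp_gen, decompGen, DirectSum.of_mul_of]
    exact of_congr (by simp) _ _ rfl

instance pieceGraded (n : ℕ) : GradedAlgebra (piece n) :=
  GradedAlgebra.ofAlgHom (piece n) (decomp n)
    (by
      apply Hhat.hom_ext
      intro g
      simp [decomp_gen, decompGen])
    (by
      rintro k ⟨x, hx⟩
      induction hx using Submodule.span_induction with
      | mem x h =>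
        obtain ⟨w, rfl, rfl⟩ := h
        exact decomp_monomial w _
      | zero =>
        rw [map_zero]
        exact (map_zero _).symm
      | add x y hx hy h1 h2 =>
        simp only at h1 h2 ⊢
        rw [map_add, h1, h2, ← map_add]
        rfl
      | smul a x hx h1 =>
        simp only at h1 ⊢
        rw [map_smul, h1, ← DirectSum.lof_eq_of (ZMod 2), ← map_smul]
        rfl)

theorem add_self_hhat {n : ℕ} (x : Hhat n) : x + x = 0 := by
  have : (2 : ZMod 2) • x = 0 := by rw [show (2 : ZMod 2) = 0 from rfl, zero_smul]
  rwa [two_smul] at this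

/-- The differentials of the generators: `d T_a = 1` and `d c = 0`. -/
def Gen.diff {n : ℕ} : Gen n → Hhat n
  | .T _ => 1
  | .c => 0
  | .cinv => 0

/-- The algebra homomorphism `x ↦ x + d x ε` to the dual numbers over `Ĥ_n`. -/
def diffHom (n : ℕ) : Hhat n →ₐ[ZMod 2] DualNumber (Hhat n) :=
  RingQuot.liftAlgHom (ZMod 2) ⟨FreeAlgebra.lift (ZMod 2)
      (fun g : Gen n => (TrivSqZeroExt.inl (gen g) + TrivSqZeroExt.inr g.diff :
        DualNumber (Hhat n))), by
    intro x y h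
    have hm := mk_rel h
    cases h <;> simp only [map_mul, map_one, map_zero, FreeAlgebra.lift_ι_apply] at hm ⊢ <;>
      apply TrivSqZeroExt.ext
    case braid.h2 a _ =>
      have h0 : ∀ b : Node n, (gen (Gen.T b) * gen (Gen.T b) : Hhat n) = 0 := fun b => by
        simpa [gen] using mk_rel (Rel.sq b)
      simp [Gen.diff, h0, add_comm]
    all_goals first
      | (simp only [TrivSqZeroExt.fst_mul, TrivSqZeroExt.fst_add, TrivSqZeroExt.fst_inl,
          TrivSqZeroExt.fst_inr, TrivSqZeroExt.fst_one, TrivSqZeroExt.fst_zero, add_zero]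
         exact hm)
      | simp [Gen.diff, add_self_hhat, add_comm]⟩

theorem diffHom_gen {n : ℕ} (g : Gen n) :
    diffHom n (gen g) = TrivSqZeroExt.inl (gen g) + TrivSqZeroExt.inr g.diff := by
  simp [diffHom, gen, RingQuot.liftAlgHom_mkAlgHom_apply]

theorem fst_diffHom {n : ℕ} (x : Hhat n) : (diffHom n x).fst = x := by
  have h : (TrivSqZeroExt.fstHom (ZMod 2) (Hhat n) (Hhat n)).comp (diffHom n)
      = AlgHom.id (ZMod 2) (Hhat n) := by
    apply Hhat.hom_ext
    intro g
    simp [diffHom_gen]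
  exact DFunLike.congr_fun h x

/-- The differential of `Ĥ_n`. -/
def diff (n : ℕ) : Hhat n →ₗ[ZMod 2] Hhat n :=
  (TrivSqZeroExt.sndHom (Hhat n) (Hhat n)).restrictScalars (ZMod 2) ∘ₗ (diffHom n).toLinearMap

theorem diff_apply {n : ℕ} (x : Hhat n) : diff n x = (diffHom n x).snd := rfl

theorem diff_gen {n : ℕ} (g : Gen n) : diff n (gen g) = g.diff := by
  simp [diff_apply, diffHom_gen]

theorem diff_T {n : ℕ} (a : Node n) : diff n (T a) = 1 := diff_gen _

theorem diff_c (n : ℕ) : diff n (c n) = 0 := diff_gen _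

theorem diff_mul {n : ℕ} (x y : Hhat n) : diff n (x * y) = diff n x * y + x * diff n y := by
  simp [diff_apply, fst_diffHom, add_comm]

theorem diff_one (n : ℕ) : diff n 1 = 0 := by
  simp [diff_apply]

theorem diff_monomial_mem {n : ℕ} (w : List (Gen n)) :
    diff n (w.map gen).prod ∈ piece n ((w.map Gen.deg).sum + 1) ∧
      diff n (diff n (w.map gen).prod) = 0 := by
  induction w with
  | nil => simp [diff_one]
  | cons g w ih =>
    have hw : (w.map gen).prod ∈ piece n (w.map Gen.deg).sum :=
      Submodule.subset_span ⟨w, rfl, rfl⟩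
    simp only [List.map_cons, List.prod_cons, List.sum_cons, diff_mul, diff_gen, map_add, ih.2]
    refine ⟨add_mem ?_ ?_, ?_⟩
    · cases g with
      | T a => simpa [Gen.diff, Gen.deg] using hw
      | c => simp [Gen.diff]
      | cinv => simp [Gen.diff]
    · rw [add_assoc]
      exact SetLike.mul_mem_graded (gen_mem g) ih.1
    · have h0 : diff n g.diff = 0 := by cases g <;> simp [Gen.diff, diff_one]
      simp [h0, add_self_hhat]

theorem mem_span_monomials {n : ℕ} (x : Hhat n) :
    x ∈ Submodule.span (ZMod 2) {x : Hhat n | ∃ w : List (Gen n), x = (w.map gen).prod} := by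
  have h : ∀ k, piece n k ≤
      Submodule.span (ZMod 2) {x : Hhat n | ∃ w : List (Gen n), x = (w.map gen).prod} := fun k =>
    Submodule.span_mono (by rintro _ ⟨w, -, rfl⟩; exact ⟨w, rfl⟩)
  classical
  rw [← DirectSum.sum_support_decompose (piece n) x]
  exact Submodule.sum_mem _ fun k _ => h k (SetLike.coe_mem _)

/-- The differential graded structure on `Ĥ_n`: `T_a` has degree `-1`, `c` has degree `0`,
`d T_a = 1` and `d c = 0`. -/
def dgStructure (n : ℕ) : DGStructure (Hhat n) where
  piece := piece n
  d := diff n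
  d_mem := by
    intro k x hx
    induction hx using Submodule.span_induction with
    | mem x h =>
      obtain ⟨w, rfl, rfl⟩ := h
      exact (diff_monomial_mem w).1
    | zero => simp
    | add x y _ _ h1 h2 => rw [map_add]; exact add_mem h1 h2
    | smul a x _ h1 => rw [map_smul]; exact Submodule.smul_mem _ _ h1
  d_mul := diff_mul
  d_d := by
    intro x
    induction mem_span_monomials x using Submodule.span_induction with
    | mem x h =>
      obtain ⟨w, rfl⟩ := h
      exact (diff_monomial_mem w).2
    | zero => simp
    | add x y _ _ h1 h2 => rw [map_add, map_add, h1, h2, add_zero]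
    | smul a x _ h1 => rw [map_smul, map_smul, h1, smul_zero]

/-! ### The presented algebra -/

/-- The index set `{1, …, n - 1}`. -/
abbrev FinNode (n : ℕ) : Type := {i : ℕ // 1 ≤ i ∧ i < n}

/-- The class modulo `n` of `i ∈ {1, …, n - 1}`. -/
def FinNode.toNode {n : ℕ} (i : FinNode n) : Node n := ⟨(i.1 : ZMod n), by have := i.2; omega⟩

/-- The generators `t_1, …, t_{n-1}` and `b` of the presented algebra. -/
inductive PosGen (n : ℕ) : Type
  | t (i : FinNode n)
  | b

open FreeAlgebra in
/-- The relations of the presented algebra: the nil Hecke relations of the symmetric group,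
`b t_i = t_{i+1} b` for `1 ≤ i < n - 1`, and `b² t_{n-1} = t_1 b²`. -/
inductive PosRel (n : ℕ) :
    FreeAlgebra (ZMod 2) (PosGen n) → FreeAlgebra (ZMod 2) (PosGen n) → Prop
  | sq (i : FinNode n) : PosRel n (ι _ (PosGen.t i) * ι _ (PosGen.t i)) 0
  | comm (i j : FinNode n) (h : 1 < |(i.1 : ℤ) - j.1|) :
      PosRel n (ι _ (PosGen.t i) * ι _ (PosGen.t j)) (ι _ (PosGen.t j) * ι _ (PosGen.t i))
  | braid (i j : FinNode n) (h : j.1 = i.1 + 1) :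
      PosRel n (ι _ (PosGen.t i) * ι _ (PosGen.t j) * ι _ (PosGen.t i))
        (ι _ (PosGen.t j) * ι _ (PosGen.t i) * ι _ (PosGen.t j))
  | b_t (i j : FinNode n) (h : j.1 = i.1 + 1) :
      PosRel n (ι _ PosGen.b * ι _ (PosGen.t i)) (ι _ (PosGen.t j) * ι _ PosGen.b)
  | b_b_t (i j : FinNode n) (hi : i.1 + 1 = n) (hj : j.1 = 1) :
      PosRel n (ι _ PosGen.b ^ 2 * ι _ (PosGen.t i)) (ι _ (PosGen.t j) * ι _ PosGen.b ^ 2)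

/-- The algebra presented by the generators `t_1, …, t_{n-1}, b` and the relations above. -/
abbrev PosAlg (n : ℕ) : Type := RingQuot (PosRel n)

/-- The class of a generator in the presented algebra. -/
def posGen {n : ℕ} (g : PosGen n) : PosAlg n :=
  RingQuot.mkAlgHom (ZMod 2) (PosRel n) (FreeAlgebra.ι _ g)

end ExtAffine

/-! The relations of the presented algebra hold in `Hhat n`: `c² T_{n-1} = T_1 c²` comes from moving
`c` past `T_{n-1}` and then past `T_0`, which is not a generator of the subalgebra. This gives
`posHom`. It has to be shown injective with image the span of the positive `T_σ`.

The tool on the side of `Hhat n` is the regular representation on the space with basis the group: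
`T_a` sends `σ` to `s_a σ` if this creates an inversion, and to zero otherwise. Applying it to the
basis vector of `1` gives the linear map `orbit`. By the exchange property `orbit` sends `Tel σ` to
the basis vector of `σ` (`orbit_Tel`), whichever reduced expression is chosen.

The tool on the side of the presentation is a set of normal forms `X_{i_1} ⋯ X_{i_d} w`, with `X_i =
t_i ⋯ t_1 b`, the indices weakly increasing and `w` a normal form of a finite permutation. Each is
carried as a pair of an algebra element and a group element, so that one rewriting serves both. Left
multiplication by a generator gives a normal form or, in the algebra, zero (`NF.exists_mul`,
`NF.b_mul`), so normal forms span `PosAlg n`. The group element determines the normal form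
(`NF.unique`), every positive element has one (`exists_NF`), and `orbit` sends the image of a normal
form to the basis vector of its group element (`NF.orbit_eq`).

Hence `orbit ∘ posHom` is injective. A power of the unit `c^n`, which commutes with all generators,
moves any element of `Hhat n` into the image, so `orbit` itself is injective. Therefore normal forms
map to the corresponding `Tel σ`, which identifies the image. It is a differential graded subalgebra
because its generators are homogeneous and have differentials `1` and `0`. -/

namespace ExtAffine

/-! ### The action on the integers -/

section Group

variable {n : ℕ}

theorem smul_add_natCast (σ : affPerm n) (r : ℤ) : σ • (r + n) = σ • r + n := by
  have h := σ.2 r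
  rw [add_comm r, add_comm (σ • r)]
  exact h

theorem smul_add_mul (σ : affPerm n) (r m : ℤ) : σ • (r + n * m) = σ • r + n * m := by
  induction m using Int.induction_on with
  | zero => simp
  | succ m ih =>
    rw [mul_add, mul_one, ← add_assoc, smul_add_natCast, ih]
    ring
  | pred m ih =>
    have h := smul_add_natCast σ (r + n * (-(m : ℤ) - 1))
    rw [show r + n * (-(m : ℤ) - 1) + n = r + n * (-(m : ℤ)) by ring, ih] at h
    linarith

theorem exists_eq_add_mul {r k : ℤ} (h : (r : ZMod n) = k) : ∃ m : ℤ, r = k + n * m := by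
  obtain ⟨m, hm⟩ := (ZMod.intCast_eq_intCast_iff_dvd_sub k r n).1 h.symm
  exact ⟨m, by linarith⟩

theorem smul_rot (r : ℤ) : rot n • r = r + 1 := rfl

theorem smul_rot_zpow (d r : ℤ) : rot n ^ d • r = r + d := rot_zpow_apply n d r

theorem smul_simple (a : Node n) (r : ℤ) : simple a • r = simpleFun a r := rfl

theorem smul_simple_left {a : Node n} {k : ℤ} (h : (k : ZMod n) = a.1) :
    simple a • k = k + 1 := by
  simp [smul_simple, simpleFun, h]

theorem smul_simple_right {a : Node n} {k : ℤ} (h : (k : ZMod n) = a.1) :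
    simple a • (k + 1) = k := by
  simp [smul_simple, simpleFun, h, one_ne_zero_zmod a.2]

theorem smul_simple_of_ne {a : Node n} {r : ℤ} (h : (r : ZMod n) ≠ a.1)
    (h' : (r : ZMod n) ≠ a.1 + 1) : simple a • r = r := by
  simp [smul_simple, simpleFun, h, h']

theorem affPerm_ext {σ τ : affPerm n} (h : ∀ r : ℤ, σ • r = τ • r) : σ = τ :=
  Subtype.ext (Equiv.ext h)

theorem simple_inv (a : Node n) : (simple a)⁻¹ = simple a :=
  inv_eq_of_mul_eq_one_left (simple_mul_self a)

/-- An element that maps `k, k + 1` to `l, l + 1` conjugates one simple reflection to another. -/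
theorem mul_simple_eq {g : affPerm n} {a b : Node n} {k l : ℤ} (hk : (k : ZMod n) = a.1)
    (hl : (l : ZMod n) = b.1) (h : g • k = l) (h' : g • (k + 1) = l + 1) :
    g * simple a = simple b * g := by
  apply affPerm_ext
  intro r
  rw [mul_smul, mul_smul]
  by_cases h1 : (r : ZMod n) = a.1
  · obtain ⟨m, rfl⟩ := exists_eq_add_mul (h1.trans hk.symm)
    rw [smul_add_mul, smul_add_mul, smul_add_mul, smul_add_mul, smul_simple_left hk, h, h',
      smul_simple_left hl]
  · by_cases h2 : (r : ZMod n) = a.1 + 1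
    · obtain ⟨m, rfl⟩ := exists_eq_add_mul (h2.trans (by rw [← hk, Int.cast_add, Int.cast_one]) :
        (r : ZMod n) = ((k + 1 : ℤ) : ZMod n))
      rw [smul_add_mul, smul_add_mul, smul_add_mul, smul_add_mul, smul_simple_right hk, h, h',
        smul_simple_right hl]
    · rw [smul_simple_of_ne h1 h2]
      -- Since `g` commutes with translation by `n`, it is injective on residue classes, so `g • r`
      -- avoids the two classes that `simple b` moves.
      have key : ∀ j : ℤ, ((g • r : ℤ) : ZMod n) = ((g • j : ℤ) : ZMod n) →
          (r : ZMod n) = j := by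
        intro j hj
        obtain ⟨m, hm⟩ := exists_eq_add_mul hj
        rw [← smul_add_mul] at hm
        rw [MulAction.injective g hm]
        simp
      rw [smul_simple_of_ne]
      · intro h3
        exact h1 ((key k (by rw [h3, h, hl])).trans hk)
      · intro h3
        apply h2
        rw [key (k + 1) (by rw [h3, h', Int.cast_add, Int.cast_one, hl]), Int.cast_add,
          Int.cast_one, hk]

theorem exists_intCast (a : Node n) : ∃ k : ℤ, (k : ZMod n) = a.1 :=
  ZMod.intCast_surjective a.1

theorem intCast_add_one {a : Node n} {k : ℤ} (h : (k : ZMod n) = a.1) :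
    ((k + 1 : ℤ) : ZMod n) = a.succ.1 := by
  simp [Node.succ, h]

theorem rot_mul_simple (a : Node n) : rot n * simple a = simple a.succ * rot n := by
  obtain ⟨k, hk⟩ := exists_intCast a
  exact mul_simple_eq hk (intCast_add_one hk) rfl rfl

/-- Nodes that are not neighbours. -/
theorem smul_simple_far {a b : Node n} (hab : a.1 ≠ b.1) (h₁ : a.1 ≠ b.1 + 1)
    (h₂ : a.1 ≠ b.1 - 1) {k : ℤ} (h : (k : ZMod n) = b.1) :
    simple a • k = k ∧ simple a • (k + 1) = k + 1 := by
  constructor <;> apply smul_simple_of_ne <;> push_cast <;> rw [h]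
  · exact hab.symm
  · intro h3; exact h₂ (by rw [h3]; ring)
  · exact h₁.symm
  · intro h3; exact hab (add_right_cancel h3).symm

theorem simple_comm {a b : Node n} (h₁ : a.1 ≠ b.1 + 1) (h₂ : a.1 ≠ b.1 - 1) :
    simple a * simple b = simple b * simple a := by
  by_cases hab : a.1 = b.1
  · rw [Subtype.ext hab]
  · obtain ⟨k, hk⟩ := exists_intCast b
    have h := smul_simple_far hab h₁ h₂ hk
    exact mul_simple_eq hk hk h.1 h.2

theorem two_ne_zero_zmod (h : 2 < n) : (2 : ZMod n) ≠ 0 := by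
  intro h2
  have := (ZMod.natCast_eq_zero_iff 2 n).1 (by exact_mod_cast h2)
  exact absurd (Nat.le_of_dvd (by norm_num) this) (by omega)

theorem smul_simple_add_two (h : 2 < n) {a : Node n} {k : ℤ} (hk : (k : ZMod n) = a.1) :
    simple a • (k + 2) = k + 2 := by
  apply smul_simple_of_ne <;> push_cast <;> rw [hk]
  · simpa using two_ne_zero_zmod h
  · intro h1
    apply one_ne_zero_zmod a.2
    linear_combination h1

theorem smul_simple_succ_self (h : 2 < n) {a : Node n} {k : ℤ} (hk : (k : ZMod n) = a.1) :
    simple a.succ • k = k := by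
  apply smul_simple_of_ne <;> rw [hk] <;> simp only [Node.succ]
  · simpa using one_ne_zero_zmod a.2
  · intro h1
    apply two_ne_zero_zmod h
    linear_combination -h1

theorem smul_simple_succ_add_one {a : Node n} {k : ℤ} (hk : (k : ZMod n) = a.1) :
    simple a.succ • (k + 1) = k + 2 := by
  rw [smul_simple_left (intCast_add_one hk)]; ring

theorem smul_simple_succ_add_two {a : Node n} {k : ℤ} (hk : (k : ZMod n) = a.1) :
    simple a.succ • (k + 2) = k + 1 := by
  rw [show k + 2 = k + 1 + 1 by ring, smul_simple_right (intCast_add_one hk)]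

theorem simple_braid (h : 2 < n) (a : Node n) :
    simple a * simple a.succ * simple a = simple a.succ * simple a * simple a.succ := by
  obtain ⟨k, hk⟩ := exists_intCast a
  rw [mul_assoc (simple a.succ)]
  apply mul_simple_eq hk (intCast_add_one hk)
  · rw [mul_smul, smul_simple_succ_self h hk, smul_simple_left hk]
  · rw [mul_smul, smul_simple_succ_add_one hk, smul_simple_add_two h hk]; ring

/-! ### The exchange property -/

/-- Apply the letters of `w` to the pair one at a time. The order of the pair must flip at some
letter, and a simple reflection flips only the pairs `r, r + 1` that it exchanges. -/
theorem exists_prefix_of_inversion (w : List (Node n)) : ∀ p q : ℤ, p < q →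
    (w.map simple).prod⁻¹ • q < (w.map simple).prod⁻¹ • p →
    ∃ (w₁ : List (Node n)) (b : Node n) (w₂ : List (Node n)) (r : ℤ), w = w₁ ++ b :: w₂ ∧
      (r : ZMod n) = b.1 ∧ (w₁.map simple).prod • r = p ∧ (w₁.map simple).prod • (r + 1) = q := by
  induction w with
  | nil =>
    intro p q h h'
    simp only [List.map_nil, List.prod_nil, inv_one, one_smul] at h'
    omega
  | cons b w ih =>
    intro p q h h'
    simp only [List.map_cons, List.prod_cons, mul_inv_rev, mul_smul, simple_inv] at h'
    by_cases hlt : simple b • p < simple b • q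
    · obtain ⟨w₁, b', w₂, r, rfl, hr, h1, h2⟩ := ih _ _ hlt h'
      refine ⟨b :: w₁, b', w₂, r, rfl, hr, ?_, ?_⟩
      · rw [List.map_cons, List.prod_cons, mul_smul, h1, ← mul_smul, simple_mul_self, one_smul]
      · rw [List.map_cons, List.prod_cons, mul_smul, h2, ← mul_smul, simple_mul_self, one_smul]
    · have hne : simple b • p ≠ simple b • q := fun he => h.ne (MulAction.injective _ he)
      refine ⟨[], b, w, p, rfl, ?_⟩
      simp only [smul_simple, simpleFun] at hlt hne
      simp only [List.map_nil, List.prod_nil, one_smul, true_and]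
      split_ifs at hlt hne with h1 h2 h3 h4 <;> first | omega | exact ⟨h1, by omega⟩

/-- Ascents: left multiplication by the simple reflection creates an inversion. -/
def IsAscent (a : Node n) (σ : affPerm n) : Prop :=
  ∀ k : ℤ, (k : ZMod n) = a.1 → σ⁻¹ • k < σ⁻¹ • (k + 1)

theorem isAscent_iff {a : Node n} {σ : affPerm n} {k : ℤ} (hk : (k : ZMod n) = a.1) :
    IsAscent a σ ↔ σ⁻¹ • k < σ⁻¹ • (k + 1) := by
  refine ⟨fun h => h k hk, fun h l hl => ?_⟩
  obtain ⟨m, rfl⟩ := exists_eq_add_mul (hl.trans hk.symm)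
  rw [add_right_comm, smul_add_mul, smul_add_mul]
  linarith

/-- The exchange property: the letter at which `k, k + 1` is inverted is conjugate to `simple a` by
the prefix before it, so multiplying by `simple a` deletes it. The power of `rot n` shifts both
points equally and plays no role. -/
theorem exists_shorter_of_not_isAscent {a : Node n} {w : List (Node n)} {d : ℤ}
    (h : ¬ IsAscent a ((w.map simple).prod * rot n ^ d)) :
    ∃ w' : List (Node n), w'.length < w.length ∧
      simple a * ((w.map simple).prod * rot n ^ d) = (w'.map simple).prod * rot n ^ d := by
  obtain ⟨k, hk⟩ := exists_intCast a
  rw [isAscent_iff hk, mul_inv_rev, mul_smul, mul_smul, ← zpow_neg, smul_rot_zpow,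
    smul_rot_zpow] at h
  have hne : (w.map simple).prod⁻¹ • k ≠ (w.map simple).prod⁻¹ • (k + 1) := fun he => by
    have := MulAction.injective _ he
    omega
  obtain ⟨w₁, b, w₂, r, rfl, hr, h1, h2⟩ :=
    exists_prefix_of_inversion w k (k + 1) (by omega) (by omega)
  refine ⟨w₁ ++ w₂, by simp, ?_⟩
  have h3 := mul_simple_eq hr hk h1 h2
  simp only [List.map_append, List.prod_append, List.map_cons, List.prod_cons]
  rw [← mul_assoc, ← mul_assoc, ← h3, mul_assoc (w₁.map simple).prod, ← mul_assoc (simple b),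
    simple_mul_self, one_mul]

end Group

/-! ### The regular representation -/

section Rep

variable (n : ℕ)

/-- The space with basis the extended affine symmetric group. -/
abbrev GroupSpace : Type := affPerm n →₀ ZMod 2

variable {n}

open Classical in
/-- The action of `T_a`. -/
noncomputable def opT (a : Node n) : Module.End (ZMod 2) (GroupSpace n) :=
  Finsupp.lsum (ZMod 2) fun σ =>
    if IsAscent a σ then Finsupp.lsingle (simple a * σ) else 0

/-- Left translation. -/
noncomputable def opMul (g : affPerm n) : Module.End (ZMod 2) (GroupSpace n) :=
  Finsupp.lsum (ZMod 2) fun σ => Finsupp.lsingle (g * σ)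

theorem opMul_single (g σ : affPerm n) :
    opMul g (Finsupp.single σ 1) = Finsupp.single (g * σ) 1 := by
  simp [opMul]

theorem opT_single_of_isAscent {a : Node n} {σ : affPerm n} (h : IsAscent a σ) :
    opT a (Finsupp.single σ 1) = Finsupp.single (simple a * σ) 1 := by
  simp [opT, h]

theorem opT_single_of_not {a : Node n} {σ : affPerm n} (h : ¬ IsAscent a σ) :
    opT a (Finsupp.single σ 1) = 0 := by
  simp [opT, h]

theorem end_ext {f g : Module.End (ZMod 2) (GroupSpace n)}
    (h : ∀ σ, f (Finsupp.single σ 1) = g (Finsupp.single σ 1)) : f = g :=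
  Finsupp.lhom_ext' fun σ => LinearMap.ext_ring (h σ)

theorem opMul_mul_opMul (g h : affPerm n) : opMul g * opMul h = opMul (g * h) := by
  apply end_ext
  intro σ
  simp [Module.End.mul_apply, opMul_single, mul_assoc]

theorem opMul_one : opMul (1 : affPerm n) = 1 := by
  apply end_ext
  intro σ
  simp [opMul_single]

theorem opT_sq (a : Node n) : opT a * opT a = 0 := by
  apply end_ext
  intro σ
  rw [Module.End.mul_apply, LinearMap.zero_apply]
  by_cases h : IsAscent a σ
  · rw [opT_single_of_isAscent h, opT_single_of_not]
    obtain ⟨k, hk⟩ := exists_intCast a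
    rw [isAscent_iff hk] at h ⊢
    rw [mul_inv_rev, mul_smul, mul_smul, simple_inv, smul_simple_left hk, smul_simple_right hk]
    omega
  · rw [opT_single_of_not h, map_zero]

theorem opMul_rot_opT (a : Node n) : opMul (rot n) * opT a = opT a.succ * opMul (rot n) := by
  apply end_ext
  intro σ
  rw [Module.End.mul_apply, Module.End.mul_apply, opMul_single]
  obtain ⟨k, hk⟩ := exists_intCast a
  have hr : ∀ r : ℤ, (rot n)⁻¹ • (r + 1) = r := fun r => by
    rw [inv_smul_eq_iff, smul_rot]
  have hiff : IsAscent a.succ (rot n * σ) ↔ IsAscent a σ := by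
    rw [isAscent_iff hk, isAscent_iff (intCast_add_one hk), mul_inv_rev, mul_smul, mul_smul,
      hr, hr]
  by_cases h : IsAscent a σ
  · rw [opT_single_of_isAscent h, opT_single_of_isAscent (hiff.2 h), opMul_single, ← mul_assoc,
      ← mul_assoc, rot_mul_simple]
  · rw [opT_single_of_not h, opT_single_of_not (mt hiff.1 h), map_zero]

theorem opT_comm {a b : Node n} (h₁ : a.1 ≠ b.1 + 1) (h₂ : a.1 ≠ b.1 - 1) :
    opT a * opT b = opT b * opT a := by
  by_cases hab : a.1 = b.1
  · rw [Subtype.ext hab]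
  have hiff : ∀ {a b : Node n} (σ : affPerm n), a.1 ≠ b.1 → a.1 ≠ b.1 + 1 → a.1 ≠ b.1 - 1 →
      (IsAscent b (simple a * σ) ↔ IsAscent b σ) := by
    intro a b σ hab h₁ h₂
    obtain ⟨k, hk⟩ := exists_intCast b
    have h := smul_simple_far hab h₁ h₂ hk
    rw [isAscent_iff hk, isAscent_iff hk, mul_inv_rev, mul_smul, mul_smul, simple_inv, h.1, h.2]
  apply end_ext
  intro σ
  rw [Module.End.mul_apply, Module.End.mul_apply]
  have hb := hiff σ hab h₁ h₂
  have ha := hiff σ (Ne.symm hab) (fun h => h₂ (by rw [h]; ring)) (fun h => h₁ (by rw [h]; ring))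
  by_cases h : IsAscent a σ <;> by_cases h' : IsAscent b σ
  · rw [opT_single_of_isAscent h, opT_single_of_isAscent h', opT_single_of_isAscent (ha.2 h),
      opT_single_of_isAscent (hb.2 h'), ← mul_assoc, ← mul_assoc, simple_comm h₁ h₂]
  · rw [opT_single_of_isAscent h, opT_single_of_not h', map_zero, opT_single_of_not (mt hb.1 h')]
  · rw [opT_single_of_isAscent h', opT_single_of_not h, map_zero, opT_single_of_not (mt ha.1 h)]
  · rw [opT_single_of_not h, opT_single_of_not h', map_zero, map_zero]

/-- Both sides test the same three comparisons among `σ⁻¹ • k`, `σ⁻¹ • (k + 1)`, `σ⁻¹ • (k + 2)`, in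
opposite orders, and give the same group element when all three hold. -/
theorem opT_braid (hn : 2 < n) (a : Node n) :
    opT a * opT a.succ * opT a = opT a.succ * opT a * opT a.succ := by
  classical
  apply end_ext
  intro σ
  obtain ⟨k, hk⟩ := exists_intCast a
  have hk' := intCast_add_one hk
  have e : ∀ (b : Node n) (τ : affPerm n) (r : ℤ),
      (simple b * τ)⁻¹ • r = τ⁻¹ • simple b • r := fun b τ r => by
    rw [mul_inv_rev, mul_smul, simple_inv]
  have e1 := smul_simple_left hk
  have e2 := smul_simple_right hk
  have e3 := smul_simple_add_two hn hk
  have e4 := smul_simple_succ_self hn hk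
  have e5 := smul_simple_succ_add_one hk
  have e6 := smul_simple_succ_add_two hk
  have i1 : ∀ τ : affPerm n, opT a (Finsupp.single τ 1) =
      if τ⁻¹ • k < τ⁻¹ • (k + 1) then Finsupp.single (simple a * τ) 1 else 0 := by
    intro τ
    simp only [← isAscent_iff hk]
    split_ifs with h
    · exact opT_single_of_isAscent h
    · exact opT_single_of_not h
  have i2 : ∀ τ : affPerm n, opT a.succ (Finsupp.single τ 1) =
      if τ⁻¹ • (k + 1) < τ⁻¹ • (k + 2) then Finsupp.single (simple a.succ * τ) 1 else 0 := by
    intro τ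
    rw [show k + 2 = k + 1 + 1 by ring]
    simp only [← isAscent_iff hk']
    split_ifs with h
    · exact opT_single_of_isAscent h
    · exact opT_single_of_not h
  have hb : simple a * (simple a.succ * (simple a * σ))
      = simple a.succ * (simple a * (simple a.succ * σ)) := by
    simp only [← mul_assoc, simple_braid hn a]
  simp only [Module.End.mul_apply, i1, i2, apply_ite, map_zero, e, e1, e2, e3, e4, e5, e6, hb]
  split_ifs <;> rfl

/-- The regular representation of `Ĥ_n`. -/
noncomputable def regRep (n : ℕ) : Hhat n →ₐ[ZMod 2] Module.End (ZMod 2) (GroupSpace n) :=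
  RingQuot.liftAlgHom (ZMod 2) ⟨FreeAlgebra.lift (ZMod 2) fun g => match g with
      | Gen.T a => opT a
      | Gen.c => opMul (rot n)
      | Gen.cinv => opMul (rot n)⁻¹, by
    intro x y h
    cases h <;> simp only [map_mul, map_one, map_zero, FreeAlgebra.lift_ι_apply]
    · rw [opMul_mul_opMul, mul_inv_cancel, opMul_one]
    · rw [opMul_mul_opMul, inv_mul_cancel, opMul_one]
    · exact opT_sq _
    · exact opMul_rot_opT _
    · exact opT_comm ‹_› ‹_›
    · exact opT_braid ‹_› _⟩

theorem regRep_T (a : Node n) : regRep n (T a) = opT a := by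
  simp [regRep, T, gen, RingQuot.liftAlgHom_mkAlgHom_apply]

theorem regRep_c : regRep n (c n) = opMul (rot n) := by
  simp [regRep, c, gen, RingQuot.liftAlgHom_mkAlgHom_apply]

/-- The orbit map of the unit in the regular representation. -/
noncomputable def orbit (n : ℕ) : Hhat n →ₗ[ZMod 2] GroupSpace n :=
  (LinearMap.applyₗ (Finsupp.single 1 1)).comp (regRep n).toLinearMap

theorem orbit_apply (x : Hhat n) : orbit n x = regRep n x (Finsupp.single 1 1) := rfl

theorem orbit_mul (x y : Hhat n) : orbit n (x * y) = regRep n x (orbit n y) := by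
  simp [orbit_apply]

theorem orbit_T_mul {a : Node n} {x : Hhat n} {σ : affPerm n}
    (hx : orbit n x = Finsupp.single σ 1) (h : IsAscent a σ) :
    orbit n (T a * x) = Finsupp.single (simple a * σ) 1 := by
  rw [orbit_mul, hx, regRep_T, opT_single_of_isAscent h]

theorem orbit_c_mul {x : Hhat n} {σ : affPerm n} (hx : orbit n x = Finsupp.single σ 1) :
    orbit n (c n * x) = Finsupp.single (rot n * σ) 1 := by
  rw [orbit_mul, hx, regRep_c, opMul_single]

theorem orbit_one : orbit n 1 = Finsupp.single 1 1 := by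
  simp [orbit_apply]

theorem orbit_cUnit_zpow (d : ℤ) :
    orbit n ((cUnit n ^ d : (Hhat n)ˣ) : Hhat n) = Finsupp.single (rot n ^ d) 1 := by
  have hinv : ∀ x : Hhat n, orbit n (((cUnit n)⁻¹ : (Hhat n)ˣ) * x)
      = opMul (rot n)⁻¹ (orbit n x) := by
    intro x
    have h : orbit n (c n * (((cUnit n)⁻¹ : (Hhat n)ˣ) * x)) = orbit n x := by
      congr 1
      exact (cUnit n).mul_inv_cancel_left x
    rw [← h, orbit_mul (c n), regRep_c, ← Module.End.mul_apply, opMul_mul_opMul, inv_mul_cancel,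
      opMul_one, Module.End.one_apply]
  induction d using Int.induction_on with
  | zero => simp [orbit_one]
  | succ d ih =>
    rw [add_comm, zpow_add, zpow_one, Units.val_mul, zpow_add, zpow_one]
    exact orbit_c_mul ih
  | pred d ih =>
    rw [sub_eq_add_neg, add_comm, zpow_add, zpow_neg_one, Units.val_mul, hinv, ih, opMul_single,
      zpow_add, zpow_neg_one]

/-- Every letter of a minimal word acts at an ascent of the product of what follows, since otherwise
the exchange property shortens the word. That property preserves `d`, so minimality is needed only
for this `d`. -/
theorem orbit_prod_of_minimal (d : ℤ) (w : List (Node n))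
    (h : ∀ w' : List (Node n), (w.map simple).prod * rot n ^ d = (w'.map simple).prod * rot n ^ d →
      w.length ≤ w'.length) :
    orbit n ((w.map T).prod * ((cUnit n ^ d : (Hhat n)ˣ) : Hhat n))
      = Finsupp.single ((w.map simple).prod * rot n ^ d) 1 := by
  induction w with
  | nil => simp [orbit_cUnit_zpow]
  | cons a w ih =>
    simp only [List.map_cons, List.prod_cons, mul_assoc] at h ⊢
    refine orbit_T_mul (ih fun w' hw' => ?_) ?_
    · have := h (a :: w') (by rw [hw', List.map_cons, List.prod_cons, mul_assoc])
      simpa using this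
    · by_contra hd
      obtain ⟨w', hl, hw'⟩ := exists_shorter_of_not_isAscent hd
      have := h w' hw'
      simp only [List.length_cons] at this
      omega

theorem orbit_Tel [NeZero n] (σ : affPerm n) : orbit n (Tel σ) = Finsupp.single σ 1 := by
  classical
  have hl : (reducedExpr σ).1.length = length σ := (exists_reduced σ).choose_spec.1
  have he : σ = ((reducedExpr σ).1.map simple).prod * rot n ^ (reducedExpr σ).2 :=
    (exists_reduced σ).choose_spec.2
  conv_rhs => rw [he]
  refine orbit_prod_of_minimal _ _ fun w' hw' => ?_
  rw [hl]
  unfold length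
  exact Nat.find_min' (exists_isExpr σ) ⟨w', _, rfl, by rw [IsExpr, ← hw']; exact he⟩

end Rep

/-! ### Normal forms -/

section NormalForm

variable {M : Type*} [Monoid M] {n : ℕ}

/-- The relations of the presented algebra that hold in a monoid: all but `t_i² = 0`. -/
structure PosRelations (n : ℕ) (t : ℕ → M) (b : M) : Prop where
  comm : ∀ i j, 1 ≤ i → i + 1 < j → j < n → t i * t j = t j * t i
  braid : ∀ i, 1 ≤ i → i + 1 < n → t i * t (i + 1) * t i = t (i + 1) * t i * t (i + 1)
  b_t : ∀ i, 1 ≤ i → i + 1 < n → b * t i = t (i + 1) * b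
  b_b_t : 2 ≤ n → b * b * t (n - 1) = t 1 * (b * b)

/-- The product `t_{m+i} ⋯ t_{m+1}`. -/
def descProd (t : ℕ → M) (m : ℕ) : ℕ → M
  | 0 => 1
  | i + 1 => t (m + i + 1) * descProd t m i

variable {t : ℕ → M} {b : M}

theorem PosRelations.descProd_of_gt (h : PosRelations n t b) (m i j : ℕ) (hj : m + i + 1 < j)
    (hn : j < n) : t j * descProd t m i = descProd t m i * t j := by
  induction i with
  | zero => simp [descProd]
  | succ i ih =>
    rw [descProd, ← mul_assoc, ← h.comm _ _ (by omega) (by omega) hn, mul_assoc, ih (by omega),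
      mul_assoc]

/-- The factor `t j` commutes down to `t (j + 1) * t j`, where the braid relation turns it into `t
(j + 1)`; this commutes with the remaining factors. -/
theorem PosRelations.descProd_of_lt (h : PosRelations n t b) (m i j : ℕ) (hm : m + 1 ≤ j)
    (hj : j < m + i) (hn : m + i < n) : t j * descProd t m i = descProd t m i * t (j + 1) := by
  induction i with
  | zero => omega
  | succ i ih =>
    by_cases hji : j = m + i
    · obtain ⟨l, rfl⟩ : ∃ l, i = l + 1 := ⟨i - 1, by omega⟩
      subst hji
      have h1 := h.descProd_of_gt m l (m + (l + 1) + 1) (by omega) (by omega)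
      have h2 := h.braid (m + (l + 1)) (by omega) (by omega)
      calc t (m + (l + 1)) * descProd t m (l + 1 + 1)
          = t (m + (l + 1)) * t (m + (l + 1) + 1) * t (m + (l + 1)) * descProd t m l := by
            simp only [descProd, mul_assoc]; rfl
        _ = t (m + (l + 1) + 1) * t (m + (l + 1)) * (t (m + (l + 1) + 1) * descProd t m l) := by
            rw [h2]; simp only [mul_assoc]
        _ = descProd t m (l + 1 + 1) * t (m + (l + 1) + 1) := by
            rw [h1]; simp only [descProd, mul_assoc]; rfl
    · rw [descProd, ← mul_assoc, h.comm _ _ (by omega) (by omega) (by omega), mul_assoc,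
        ih (by omega) (by omega), mul_assoc]

/-- The product `t_i ⋯ t_1 b`. -/
def stepProd (t : ℕ → M) (b : M) (i : ℕ) : M := descProd t 0 i * b

theorem stepProd_succ (i : ℕ) : t (i + 1) * stepProd t b i = stepProd t b (i + 1) := by
  simp [stepProd, descProd, mul_assoc]

theorem PosRelations.stepProd_of_gt (h : PosRelations n t b) (i j : ℕ) (hj : i + 1 < j)
    (hn : j < n) : t j * stepProd t b i = stepProd t b i * t (j - 1) := by
  obtain ⟨l, rfl⟩ : ∃ l, j = l + 1 := ⟨j - 1, by omega⟩
  rw [stepProd, ← mul_assoc, h.descProd_of_gt _ _ _ (by omega) hn, mul_assoc, mul_assoc,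
    Nat.add_sub_cancel, h.b_t l (by omega) hn]

theorem PosRelations.stepProd_of_lt (h : PosRelations n t b) (i j : ℕ) (hj : 1 ≤ j)
    (hji : j < i) (hn : i < n) : t j * stepProd t b i = stepProd t b i * t j := by
  rw [stepProd, ← mul_assoc, h.descProd_of_lt _ _ _ (by omega) (by omega) (by omega), mul_assoc,
    mul_assoc, h.b_t j hj (by omega)]

/-- The only rewriting of normal forms that needs the relation for `b²`, which is the case `i = 0`.
The braid relation carries it to larger `i`. -/
theorem PosRelations.stepProd_stepProd (h : PosRelations n t b) (i : ℕ) (hi : i + 1 < n) :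
    t (i + 1) * (stepProd t b i * stepProd t b i)
      = stepProd t b i * stepProd t b i * t (n - 1) := by
  induction i with
  | zero => simp [stepProd, descProd, h.b_b_t (by omega)]
  | succ i ih =>
    have h1 := h.stepProd_of_gt i (i + 1 + 1) (by omega) hi
    rw [Nat.add_sub_cancel] at h1
    have h2 := h.braid (i + 1) (by omega) hi
    rw [← stepProd_succ]
    set X := stepProd t b i
    calc t (i + 1 + 1) * (t (i + 1) * X * (t (i + 1) * X))
        = t (i + 1 + 1) * t (i + 1) * (X * t (i + 1)) * X := by simp only [mul_assoc]
      _ = t (i + 1) * t (i + 1 + 1) * (t (i + 1) * (X * X)) := by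
          rw [← h1, ← mul_assoc, ← h2]; simp only [mul_assoc]
      _ = t (i + 1) * (X * t (i + 1)) * X * t (n - 1) := by
          rw [ih (by omega), ← h1]; simp only [mul_assoc]
      _ = t (i + 1) * X * (t (i + 1) * X) * t (n - 1) := by simp only [mul_assoc]

end NormalForm

/-! ### The two instances of the relations -/

section Instances

variable {n : ℕ}

/-- The generator `t_j` of the presented algebra, zero if `j` is out of range. -/
def posT (n j : ℕ) : PosAlg n :=
  if h : 1 ≤ j ∧ j < n then posGen (PosGen.t ⟨j, h⟩) else 0

/-- The simple reflection `s_j`, one if `j` is out of range. -/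
def posS (n j : ℕ) : affPerm n :=
  if h : 1 ≤ j ∧ j < n then simple (FinNode.toNode ⟨j, h⟩) else 1

theorem posT_eq {j : ℕ} (h : 1 ≤ j ∧ j < n) : posT n j = posGen (PosGen.t ⟨j, h⟩) := dif_pos h

theorem posS_eq {j : ℕ} (h : 1 ≤ j ∧ j < n) : posS n j = simple (FinNode.toNode ⟨j, h⟩) :=
  dif_pos h

theorem pos_mk_rel {x y : FreeAlgebra (ZMod 2) (PosGen n)} (h : PosRel n x y) :
    RingQuot.mkAlgHom (ZMod 2) (PosRel n) x = RingQuot.mkAlgHom (ZMod 2) (PosRel n) y :=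
  RingQuot.mkAlgHom_rel (ZMod 2) h

theorem posT_sq (j : ℕ) : posT n j * posT n j = 0 := by
  by_cases h : 1 ≤ j ∧ j < n
  · simpa [posT_eq h, posGen] using pos_mk_rel (PosRel.sq ⟨j, h⟩)
  · simp [posT, h]

theorem posT_relations : PosRelations n (posT n) (posGen PosGen.b) where
  comm i j hi hij hj := by
    rw [posT_eq ⟨hi, by omega⟩, posT_eq ⟨by omega, hj⟩]
    simpa [posGen] using pos_mk_rel (PosRel.comm ⟨i, hi, by omega⟩ ⟨j, by omega, hj⟩
      (by rw [lt_abs]; right; push_cast; omega))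
  braid i hi hn := by
    rw [posT_eq ⟨hi, by omega⟩, posT_eq ⟨by omega, hn⟩]
    simpa [posGen] using pos_mk_rel (PosRel.braid ⟨i, hi, by omega⟩ ⟨i + 1, by omega, hn⟩ rfl)
  b_t i hi hn := by
    rw [posT_eq ⟨hi, by omega⟩, posT_eq ⟨by omega, hn⟩]
    simpa [posGen] using pos_mk_rel (PosRel.b_t ⟨i, hi, by omega⟩ ⟨i + 1, by omega, hn⟩ rfl)
  b_b_t hn := by
    rw [posT_eq ⟨by omega, by omega⟩, posT_eq ⟨by omega, by omega⟩]
    simpa [posGen, sq] using pos_mk_rel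
      (PosRel.b_b_t ⟨n - 1, by omega, by omega⟩ ⟨1, by omega, by omega⟩ (by simp; omega) rfl)

theorem toNode_cast {j : ℕ} (h : 1 ≤ j ∧ j < n) :
    ((j : ℤ) : ZMod n) = (FinNode.toNode ⟨j, h⟩).1 := by
  simp [FinNode.toNode]

theorem natCast_ne_natCast {i j : ℕ} (hij : i < j) (hj : j < i + n) : (i : ZMod n) ≠ j := by
  intro h
  have := (ZMod.natCast_eq_natCast_iff' i j n).1 h
  have h1 := (Nat.modEq_iff_dvd' hij.le).1 this
  exact absurd (Nat.le_of_dvd (by omega) h1) (by omega)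

theorem toNode_far {i j : ℕ} (hi : 1 ≤ i ∧ i < n) (hj : 1 ≤ j ∧ j < n)
    (h : i + 1 < j ∨ j + 1 < i) :
    (FinNode.toNode ⟨i, hi⟩).1 ≠ (FinNode.toNode ⟨j, hj⟩).1 + 1 ∧
      (FinNode.toNode ⟨i, hi⟩).1 ≠ (FinNode.toNode ⟨j, hj⟩).1 - 1 := by
  simp only [FinNode.toNode]
  constructor
  · intro h1
    have h2 : ((i : ℕ) : ZMod n) = ((j + 1 : ℕ) : ZMod n) := by push_cast; exact h1
    rcases h with h | h
    · exact natCast_ne_natCast (by omega) (by omega) h2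
    · exact natCast_ne_natCast (by omega) (by omega) h2.symm
  · intro h1
    have h2 : ((i + 1 : ℕ) : ZMod n) = ((j : ℕ) : ZMod n) := by push_cast; rw [h1]; ring
    rcases h with h | h
    · exact natCast_ne_natCast (by omega) (by omega) h2
    · exact natCast_ne_natCast (by omega) (by omega) h2.symm

theorem toNode_succ {i : ℕ} (hi : 1 ≤ i ∧ i < n) (hi' : 1 ≤ i + 1 ∧ i + 1 < n) :
    (FinNode.toNode ⟨i, hi⟩).succ = FinNode.toNode ⟨i + 1, hi'⟩ := by
  apply Subtype.ext
  simp [FinNode.toNode, Node.succ]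

theorem toNode_succ_succ (hi : 1 ≤ n - 1 ∧ n - 1 < n) (hi' : 1 ≤ 1 ∧ 1 < n) :
    (FinNode.toNode ⟨n - 1, hi⟩).succ.succ = FinNode.toNode ⟨1, hi'⟩ := by
  apply Subtype.ext
  simp [FinNode.toNode, Node.succ, Nat.cast_sub hi'.2.le]

theorem posS_relations : PosRelations n (posS n) (rot n) where
  comm i j hi hij hj := by
    have h := toNode_far (n := n) ⟨hi, by omega⟩ ⟨by omega, hj⟩ (Or.inl hij)
    rw [posS_eq ⟨hi, by omega⟩, posS_eq ⟨by omega, hj⟩, simple_comm h.1 h.2]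
  braid i hi hn := by
    rw [posS_eq ⟨hi, by omega⟩, posS_eq ⟨by omega, hn⟩, ← toNode_succ, simple_braid (by omega)]
  b_t i hi hn := by
    rw [posS_eq ⟨hi, by omega⟩, posS_eq ⟨by omega, hn⟩, ← toNode_succ, rot_mul_simple]
  -- Conjugating by `rot n` twice moves the node `n - 1` to `0` and then to `1`.
  b_b_t hn := by
    rw [posS_eq ⟨by omega, by omega⟩, posS_eq ⟨by omega, by omega⟩,
      ← toNode_succ_succ ⟨by omega, by omega⟩, mul_assoc, rot_mul_simple, ← mul_assoc,
      rot_mul_simple, mul_assoc]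

/-- Pairs of an element of the presented algebra and a group element that it lifts. -/
abbrev Lift (n : ℕ) : Type := PosAlg n × affPerm n

/-- The lift `(t_j, s_j)` of a simple reflection. -/
def liftT (n j : ℕ) : Lift n := (posT n j, posS n j)

/-- The lift `(b, c)` of the rotation. -/
def liftB (n : ℕ) : Lift n := (posGen PosGen.b, rot n)

/-- Squares are the only relations that differ: `t_j² = 0` in the algebra, `s_j² = 1` in the group.
All other rewriting can be done in the product monoid, for both components at once. -/
theorem lift_relations : PosRelations n (liftT n) (liftB n) where
  comm i j hi hij hj :=
    Prod.ext (posT_relations.comm i j hi hij hj) (posS_relations.comm i j hi hij hj)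
  braid i hi hn := Prod.ext (posT_relations.braid i hi hn) (posS_relations.braid i hi hn)
  b_t i hi hn := Prod.ext (posT_relations.b_t i hi hn) (posS_relations.b_t i hi hn)
  b_b_t hn := Prod.ext (posT_relations.b_b_t hn) (posS_relations.b_b_t hn)

theorem posS_mul_self (j : ℕ) : posS n j * posS n j = 1 := by
  by_cases h : 1 ≤ j ∧ j < n
  · rw [posS_eq h, simple_mul_self]
  · simp [posS, h]

theorem posS_inv (j : ℕ) : (posS n j)⁻¹ = posS n j :=
  inv_eq_of_mul_eq_one_left (posS_mul_self j)

theorem posS_left {j : ℕ} (h : 1 ≤ j) (hj : j < n) : posS n j • (j : ℤ) = j + 1 := by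
  rw [posS_eq ⟨h, hj⟩, smul_simple_left (toNode_cast _)]

theorem posS_right {j : ℕ} (h : 1 ≤ j) (hj : j < n) : posS n j • ((j : ℤ) + 1) = j := by
  rw [posS_eq ⟨h, hj⟩, smul_simple_right (toNode_cast _)]

/-- `s_j` moves whole residue classes, so `r` is confined to the window `1, …, n`, where congruence
modulo `n` is equality. -/
theorem posS_of_ne {j : ℕ} (h : 1 ≤ j) (hj : j < n) {r : ℤ} (h0 : 0 < r) (hr : r ≤ n)
    (h1 : r ≠ j) (h2 : r ≠ j + 1) : posS n j • r = r := by
  have key : ∀ l : ℤ, 0 < l → l ≤ n → (r : ZMod n) = (l : ZMod n) → r = l := by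
    intro l hl hl' he
    obtain ⟨m, hm⟩ := exists_eq_add_mul he
    have hm0 : m = 0 := by
      by_contra hm0
      rcases lt_or_gt_of_ne hm0 with hlt | hgt
      · nlinarith
      · nlinarith
    rw [hm, hm0]; ring
  rw [posS_eq ⟨h, hj⟩]
  apply smul_simple_of_ne <;> rw [← toNode_cast ⟨h, hj⟩]
  · exact fun he => h1 (key j (by omega) (by omega) he)
  · intro he
    refine h2 (key (j + 1) (by omega) (by omega) ?_)
    rw [he]; push_cast; rfl

theorem smul_pos_of_range {σ : affPerm n} (hn : 0 < n)
    (h : ∀ r : ℤ, 0 < r → r ≤ n → 0 < σ • r) (r : ℤ) (hr : 0 < r) : 0 < σ • r := by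
  have hn' : (0 : ℤ) < n := by exact_mod_cast hn
  have h1 := Int.emod_add_mul_ediv (r - 1) n
  have h2 := Int.emod_nonneg (r - 1) hn'.ne'
  have h3 := Int.emod_lt_of_pos (r - 1) hn'
  have h4 : 0 ≤ (r - 1) / n := Int.ediv_nonneg (by omega) hn'.le
  rw [show r = ((r - 1) % n + 1) + n * ((r - 1) / n) by linarith, smul_add_mul]
  have := h ((r - 1) % n + 1) (by omega) (by omega)
  positivity

theorem posS_mem (j : ℕ) : posS n j ∈ posAffPerm n := by
  by_cases h : 1 ≤ j ∧ j < n
  · refine smul_pos_of_range (by omega) fun r h0 hr => ?_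
    by_cases h1 : r = j
    · rw [h1, posS_left h.1 h.2]; omega
    · by_cases h2 : r = j + 1
      · rw [h2, posS_right h.1 h.2]; omega
      · rwa [posS_of_ne h.1 h.2 h0 hr h1 h2]
  · rw [posS, dif_neg h]; exact one_mem _

theorem rot_mem : rot n ∈ posAffPerm n := fun r hr => by
  change 0 < r + 1
  omega

end Instances

/-! ### Action of the products `descProd` and `stepProd` on the integers -/

section Group

variable {n : ℕ}

theorem snd_descProd (m i : ℕ) : (descProd (liftT n) m i).2 = descProd (posS n) m i := by
  induction i with
  | zero => rfl
  | succ i ih => rw [descProd, descProd, Prod.snd_mul, ih]; rfl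

theorem snd_stepProd (i : ℕ) :
    (stepProd (liftT n) (liftB n) i).2 = stepProd (posS n) (rot n) i := by
  rw [stepProd, stepProd, Prod.snd_mul, snd_descProd]; rfl

theorem descProd_smul_first (m i : ℕ) (h : m + i < n) :
    descProd (posS n) m i • ((m : ℤ) + 1) = m + i + 1 := by
  induction i with
  | zero => simp [descProd]
  | succ i ih =>
    have := posS_left (n := n) (j := m + i + 1) (by omega) (by omega)
    rw [descProd, mul_smul, ih (by omega)]
    push_cast at this ⊢
    rw [this]; ring

theorem descProd_smul_of_le (m i : ℕ) (h : m + i < n) (r : ℤ) (h0 : 0 < r) (hr : r ≤ m) :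
    descProd (posS n) m i • r = r := by
  induction i with
  | zero => simp [descProd]
  | succ i ih =>
    rw [descProd, mul_smul, ih (by omega), posS_of_ne] <;> push_cast <;> omega

theorem descProd_smul_of_gt (m i : ℕ) (h : m + i < n) (r : ℤ) (h0 : m + i + 1 < r) (hr : r ≤ n) :
    descProd (posS n) m i • r = r := by
  induction i with
  | zero => simp [descProd]
  | succ i ih =>
    push_cast at h0
    rw [descProd, mul_smul, ih (by omega) (by omega), posS_of_ne] <;> push_cast <;> omega

theorem descProd_smul_mid (m i : ℕ) (h : m + i < n) (r : ℤ) (h0 : m < r) (hr : r ≤ m + i) :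
    descProd (posS n) m i • (r + 1) = r := by
  induction i with
  | zero => push_cast at hr; omega
  | succ i ih =>
    push_cast at hr
    rw [descProd, mul_smul]
    by_cases h1 : r = m + i + 1
    · have := posS_right (n := n) (j := m + i + 1) (by omega) (by omega)
      push_cast at this
      rw [h1, descProd_smul_of_gt _ _ (by omega) _ (by omega) (by omega), this]
    · rw [ih (by omega) (by omega), posS_of_ne] <;> push_cast <;> omega

theorem descProd_mem (m i : ℕ) : descProd (posS n) m i ∈ posAffPerm n := by
  induction i with
  | zero => exact one_mem _
  | succ i ih => exact mul_mem (posS_mem _) ih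

theorem descProd_inv_mem (m i : ℕ) : (descProd (posS n) m i)⁻¹ ∈ posAffPerm n := by
  induction i with
  | zero => rw [descProd, inv_one]; exact one_mem _
  | succ i ih => rw [descProd, mul_inv_rev, posS_inv]; exact mul_mem ih (posS_mem _)

theorem stepProd_mem (i : ℕ) : stepProd (posS n) (rot n) i ∈ posAffPerm n :=
  mul_mem (descProd_mem _ _) rot_mem

theorem stepProd_inv_smul (i : ℕ) (hi : i < n) :
    (stepProd (posS n) (rot n) i)⁻¹ • ((i : ℤ) + 1) = 0 := by
  have := descProd_smul_first (n := n) 0 i (by omega)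
  rw [inv_smul_eq_iff, stepProd, mul_smul, smul_rot]
  simpa using this.symm

theorem stepProd_inv_smul_of_le (i : ℕ) (hi : i < n) (r : ℤ) (h0 : 0 < r) (hr : r ≤ i) :
    (stepProd (posS n) (rot n) i)⁻¹ • r = r := by
  rw [inv_smul_eq_iff, stepProd, mul_smul, smul_rot,
    descProd_smul_mid 0 i (by omega) r (by simpa using h0) (by simpa using hr)]

end Group

/-! ### Normal forms of finite permutations -/

section FinNF

variable {n : ℕ}

/-- The normal forms of the elements that permute `m + 1, …, n`. -/
inductive FinNF : ℕ → Lift n → Prop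
  | one : FinNF n 1
  | step {m : ℕ} {i : ℕ} {z : Lift n} : FinNF (m + 1) z → m + i < n →
      FinNF m (descProd (liftT n) m i * z)

theorem FinNF.le {m : ℕ} {z : Lift n} (h : FinNF m z) : m ≤ n := by
  induction h <;> omega

theorem FinNF.smul_eq {m : ℕ} {z : Lift n} (h : FinNF m z) :
    ∀ r : ℤ, 0 < r → r ≤ m → z.2 • r = r := by
  induction h with
  | one => intro r _ _; simp
  | step _ hi ih =>
    intro r h0 hr
    rw [Prod.snd_mul, mul_smul, ih r h0 (by push_cast; omega), snd_descProd,
      descProd_smul_of_le _ _ hi r h0 hr]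

theorem FinNF.mem {m : ℕ} {z : Lift n} (h : FinNF m z) : z.2 ∈ posAffPerm n := by
  induction h with
  | one => exact one_mem _
  | step _ hi ih => rw [Prod.snd_mul, snd_descProd]; exact mul_mem (descProd_mem _ _) ih

theorem FinNF.inv_mem {m : ℕ} {z : Lift n} (h : FinNF m z) : z.2⁻¹ ∈ posAffPerm n := by
  induction h with
  | one => rw [Prod.snd_one, inv_one]; exact one_mem _
  | step _ hi ih =>
    rw [Prod.snd_mul, snd_descProd, mul_inv_rev]
    exact mul_mem ih (descProd_inv_mem _ _)

/-- The remaining factor fixes `m + 1`, so the image of `m + 1` is `m + i + 1` and reveals `i`. -/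
theorem FinNF.unique {m : ℕ} {z : Lift n} (h : FinNF m z) :
    ∀ z' : Lift n, FinNF m z' → z.2 = z'.2 → z = z' := by
  induction h with
  | one =>
    intro z' h' _
    cases h' with
    | one => rfl
    | step h1 _ => have := h1.le; omega
  | @step m i z h hi ih =>
    intro z' h' he
    cases h' with
    | one => have := h.le; omega
    | @step _ i' z' h' hi' =>
      have h1 := congrArg (fun σ : affPerm n => σ • ((m : ℤ) + 1)) he
      simp only [Prod.snd_mul, mul_smul, snd_descProd] at h1
      rw [h.smul_eq _ (by omega) (by push_cast; omega),
        h'.smul_eq _ (by omega) (by push_cast; omega), descProd_smul_first _ _ hi,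
        descProd_smul_first _ _ hi'] at h1
      obtain rfl : i = i' := by omega
      rw [Prod.snd_mul, Prod.snd_mul] at he
      rw [ih z' h' (mul_left_cancel he)]

/-- The group product always has a normal form, even when the algebra product vanishes; both facts
are used later. For `j` relative to the top index `m + i`: below it, `t_j` passes through as
`t_{j+1}`; at it, a square appears; just above it, the product lengthens; further up, `t_j`
commutes. -/
theorem FinNF.exists_mul {m : ℕ} {z : Lift n} (h : FinNF m z) : ∀ j, m + 1 ≤ j → j < n →
    ∃ z' : Lift n, FinNF m z' ∧ z'.2 = posS n j * z.2 ∧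
      (liftT n j * z = z' ∨ posT n j * z.1 = 0) := by
  induction h with
  | one => intro j h1 h2; omega
  | @step m i z h hi ih =>
    intro j hj hn
    have key : ∀ k, m + 2 ≤ k → k < n →
        liftT n j * descProd (liftT n) m i = descProd (liftT n) m i * liftT n k →
        ∃ z' : Lift n, FinNF m z' ∧ z'.2 = posS n j * (descProd (liftT n) m i * z).2 ∧
          (liftT n j * (descProd (liftT n) m i * z) = z' ∨
            posT n j * (descProd (liftT n) m i * z).1 = 0) := by
      intro k hk hkn he
      obtain ⟨z', h1, h2, h3⟩ := ih k hk hkn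
      refine ⟨_, h1.step hi, ?_, ?_⟩
      · have := congrArg Prod.snd he
        rw [Prod.snd_mul, Prod.snd_mul] at this
        rw [Prod.snd_mul, Prod.snd_mul, h2, ← mul_assoc, ← mul_assoc]
        exact congrArg (· * z.2) this.symm
      · rcases h3 with h3 | h3
        · left
          rw [← mul_assoc, he, mul_assoc, h3]
        · right
          have := congrArg Prod.fst he
          rw [Prod.fst_mul, Prod.fst_mul] at this
          change posT n j * _ = _ * posT n k at this
          rw [Prod.fst_mul, ← mul_assoc, this, mul_assoc, h3, mul_zero]
    rcases lt_trichotomy j (m + i) with h1 | h1 | h1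
    · exact key (j + 1) (by omega) (by omega) (lift_relations.descProd_of_lt _ _ _ hj h1 hi)
    · obtain ⟨l, rfl⟩ : ∃ l, i = l + 1 := ⟨i - 1, by omega⟩
      subst h1
      refine ⟨_, h.step (i := l) (by omega), ?_, Or.inr ?_⟩
      · rw [descProd, Prod.snd_mul, Prod.snd_mul, Prod.snd_mul]
        change _ = posS n (m + (l + 1)) * (posS n (m + (l + 1)) * _ * _)
        rw [mul_assoc, ← mul_assoc, posS_mul_self, one_mul]
      · rw [descProd, Prod.fst_mul, Prod.fst_mul]
        change posT n (m + (l + 1)) * (posT n (m + (l + 1)) * _ * _) = 0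
        rw [mul_assoc, ← mul_assoc, posT_sq, zero_mul]
    · by_cases h2 : j = m + i + 1
      · subst h2
        refine ⟨_, h.step (i := i + 1) (by omega), ?_, Or.inl ?_⟩
        · rw [descProd, mul_assoc]; rfl
        · rw [descProd, mul_assoc]
      · exact key j (by omega) hn (lift_relations.descProd_of_gt _ _ _ (by omega) hn)

end FinNF

/-! ### Normal forms of positive elements -/

section NF

variable {n : ℕ}

/-- The normal forms `X_{i_1} ⋯ X_{i_d} w`, where `X_i = t_i ⋯ t_1 b`, the sequence `i` is weakly
increasing and `w` is a normal form of a permutation of `1, …, n`. -/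
inductive NF : ℕ → Lift n → Prop
  | fin {z : Lift n} : FinNF 0 z → NF 0 z
  | step {d i : ℕ} {z : Lift n} : NF d z → i < n → (∀ r : ℤ, 0 < r → r ≤ i → 0 < z.2⁻¹ • r) →
      NF (d + 1) (stepProd (liftT n) (liftB n) i * z)

theorem NF.mem {d : ℕ} {z : Lift n} (h : NF d z) : z.2 ∈ posAffPerm n := by
  induction h with
  | fin h => exact h.mem
  | step _ _ _ ih => rw [Prod.snd_mul, snd_stepProd]; exact mul_mem (stepProd_mem _) ih

theorem NF.inv_smul_zero {d : ℕ} {z : Lift n} (h : NF d z) : z.2⁻¹ • (0 : ℤ) ≤ 0 := by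
  by_contra hc
  have := h.mem (z.2⁻¹ • (0 : ℤ)) (by omega)
  change 0 < z.2 • z.2⁻¹ • (0 : ℤ) at this
  rw [smul_inv_smul] at this
  omega

theorem step_inv_smul_of_le {i : ℕ} (z : Lift n) (hi : i < n) {r : ℤ} (h0 : 0 < r) (hr : r ≤ i) :
    (stepProd (liftT n) (liftB n) i * z).2⁻¹ • r = z.2⁻¹ • r := by
  rw [Prod.snd_mul, snd_stepProd, mul_inv_rev, mul_smul, stepProd_inv_smul_of_le i hi r h0 hr]

/-- When `z` is a normal form, `z.2⁻¹ • 0 ≤ 0`, so `i + 1` has a nonpositive preimage under the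
product. The side condition of `NF.step` makes it the least such positive integer. That condition
thus says that the next index, if any, is at least `i`. -/
theorem step_inv_smul {i : ℕ} (z : Lift n) (hi : i < n) :
    (stepProd (liftT n) (liftB n) i * z).2⁻¹ • ((i : ℤ) + 1) = z.2⁻¹ • (0 : ℤ) := by
  rw [Prod.snd_mul, snd_stepProd, mul_inv_rev, mul_smul, stepProd_inv_smul i hi]

/-- The index of the first factor is determined by the group element. -/
theorem step_index_le {d i i' : ℕ} {z z' : Lift n} (h : NF d z) (hi : i < n) (hi' : i' < n)
    (hz' : ∀ r : ℤ, 0 < r → r ≤ i' → 0 < z'.2⁻¹ • r)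
    (he : (stepProd (liftT n) (liftB n) i * z).2 = (stepProd (liftT n) (liftB n) i' * z').2) :
    i' ≤ i := by
  by_contra hlt
  have h1 := step_inv_smul z hi
  rw [he, step_inv_smul_of_le z' hi' (by omega) (by omega)] at h1
  have h2 := hz' (i + 1) (by omega) (by omega)
  have h3 := h.inv_smul_zero
  omega

theorem NF.unique {d : ℕ} {z : Lift n} (h : NF d z) :
    ∀ (d' : ℕ) (z' : Lift n), NF d' z' → z.2 = z'.2 → z = z' := by
  -- A finite permutation has positive preimages of all positive integers, whereas a step makes that
  -- of `i + 1` nonpositive.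
  have aux : ∀ {d i : ℕ} {z y : Lift n}, NF d z → i < n → FinNF 0 y →
      y.2 ≠ (stepProd (liftT n) (liftB n) i * z).2 := by
    intro d i z y h hi hy he
    have h1 := step_inv_smul z hi
    rw [← he] at h1
    have h2 := hy.inv_mem ((i : ℤ) + 1) (by omega)
    have h3 := h.inv_smul_zero
    change 0 < y.2⁻¹ • ((i : ℤ) + 1) at h2
    omega
  induction h with
  | fin h =>
    intro d' z' h' he
    cases h' with
    | fin h' => exact h.unique _ h' he
    | step h' hi' _ => exact absurd he (aux h' hi' h)
  | @step d i z h hi hz ih =>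
    intro d' z' h' he
    cases h' with
    | fin h' => exact absurd he.symm (aux h hi h')
    | @step d' i' z' h' hi' hz' =>
      obtain rfl : i = i' := le_antisymm (step_index_le h' hi' hi hz he.symm)
        (step_index_le h hi hi' hz' he)
      rw [Prod.snd_mul, Prod.snd_mul] at he
      rw [ih _ _ h' (mul_left_cancel he)]

theorem NF.b_mul [NeZero n] {d : ℕ} {z : Lift n} (h : NF d z) : NF (d + 1) (liftB n * z) := by
  have := h.step (i := 0) (NeZero.pos n) (fun r h0 hr => by push_cast at hr; omega)
  simpa [stepProd, descProd] using this

theorem NF.exists_mul (d : ℕ) : ∀ z : Lift n, NF d z → ∀ j, 1 ≤ j → j < n →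
    ∃ z' : Lift n, NF d z' ∧ z'.2 = posS n j * z.2 ∧
      (liftT n j * z = z' ∨ posT n j * z.1 = 0) := by
  -- Strong induction, because one of the cases below removes two factors `X_i` at once.
  induction d using Nat.strong_induction_on with
  | _ d IH =>
  intro z hz j hj hn
  cases hz with
  | fin h =>
    obtain ⟨z', h1, h2, h3⟩ := h.exists_mul j (by omega) hn
    exact ⟨z', NF.fin h1, h2, h3⟩
  | @step d i z h hi hz =>
    -- The common pattern: `t_j` passes a prefix `x` of one or two factors and becomes `t_k`, and
    -- induction applies to the rest.
    have key : ∀ (x : Lift n) (e : ℕ) (y : Lift n) (k : ℕ), e < d + 1 → NF e y → 1 ≤ k → k < n →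
        (∀ y', NF e y' → y'.2 = posS n k * y.2 → NF (d + 1) (x * y')) →
        liftT n j * (x * y) = x * liftT n k * y →
        ∃ z' : Lift n, NF (d + 1) z' ∧ z'.2 = posS n j * (x * y).2 ∧
          (liftT n j * (x * y) = z' ∨ posT n j * (x * y).1 = 0) := by
      intro x e y k hed hy hk hkn hnf he
      obtain ⟨y', h1, h2, h3⟩ := IH e hed y hy k hk hkn
      refine ⟨_, hnf y' h1 h2, ?_, ?_⟩
      · have := congrArg Prod.snd he
        simp only [Prod.snd_mul] at this
        change posS n j * _ = _ * posS n k * _ at this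
        rw [Prod.snd_mul, Prod.snd_mul, this, h2, mul_assoc]
      · rcases h3 with h3 | h3
        · left
          rw [he, mul_assoc, h3]
        · right
          have := congrArg Prod.fst he
          simp only [Prod.fst_mul] at this
          change posT n j * _ = _ * posT n k * _ at this
          rw [Prod.fst_mul, this, mul_assoc, h3, mul_zero]
    rcases lt_trichotomy j i with h1 | h1 | h1
    -- Here `j + 1 ≤ i`, so `s_j` permutes `1, …, i` and the side condition survives.
    · refine key _ d z j (by omega) h hj hn (fun y' hy' he => hy'.step hi fun r h0 hr => ?_) ?_
      · rw [he, mul_inv_rev, mul_smul, posS_inv]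
        apply hz
        · exact posS_mem j r h0
        · by_cases hr1 : r = j
          · rw [hr1, posS_left hj hn]; omega
          · by_cases hr2 : r = j + 1
            · rw [hr2, posS_right hj hn]; omega
            · rwa [posS_of_ne hj hn h0 (by omega) hr1 hr2]
      · rw [← mul_assoc, lift_relations.stepProd_of_lt i j hj h1 hi]
    · obtain ⟨l, rfl⟩ : ∃ l, i = l + 1 := ⟨i - 1, by omega⟩
      subst h1
      refine ⟨_, h.step (i := l) (by omega) fun r h0 hr => hz r h0 (by push_cast; omega), ?_,
        Or.inr ?_⟩
      · rw [← stepProd_succ, Prod.snd_mul, Prod.snd_mul, Prod.snd_mul]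
        change _ = posS n (l + 1) * (posS n (l + 1) * _ * _)
        rw [mul_assoc, ← mul_assoc, posS_mul_self, one_mul]
      · rw [← stepProd_succ, Prod.fst_mul, Prod.fst_mul]
        change posT n (l + 1) * (posT n (l + 1) * _ * _) = 0
        rw [mul_assoc, ← mul_assoc, posT_sq, zero_mul]
    · by_cases h2 : j = i + 1
      · subst h2
        -- This is exactly the additional side condition for replacing `X_i` by `t_{i+1} X_i =
        -- X_{i+1}`.
        by_cases hpos : 0 < z.2⁻¹ • ((i : ℤ) + 1)
        · refine ⟨_, h.step (i := i + 1) hn fun r h0 hr => ?_, ?_, Or.inl ?_⟩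
          · by_cases hr1 : r = i + 1
            · rwa [hr1]
            · exact hz r h0 (by push_cast at hr; omega)
          · rw [← stepProd_succ, mul_assoc]; rfl
          · rw [← stepProd_succ, mul_assoc]
        · cases h with
          | fin h => exact absurd (h.inv_mem ((i : ℤ) + 1) (by omega)) hpos
          | @step e i' y hy hi' hy' =>
            -- `i + 1` is the least positive integer with a nonpositive preimage under `z`, so `z`
            -- starts with `X_i` as well. The identity for `t_{i+1} X_i X_i` then applies, and
            -- `s_{n-1}` fixes `1, …, i` because `i < n - 1`.
            obtain rfl : i = i' := by
              apply le_antisymm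
              · by_contra hlt
                have h3 := hz (i' + 1) (by omega) (by omega)
                rw [step_inv_smul y hi'] at h3
                have := hy.inv_smul_zero
                omega
              · by_contra hlt
                apply hpos
                rw [step_inv_smul_of_le y hi' (by omega) (by omega)]
                exact hy' _ (by omega) (by omega)
            rw [← mul_assoc]
            refine key _ e y (n - 1) (by omega) hy (by omega) (by omega) (fun y' h3 he => ?_) ?_
            · have hc : ∀ r : ℤ, 0 < r → r ≤ i → 0 < y'.2⁻¹ • r := by
                intro r h0 hr
                rw [he, mul_inv_rev, mul_smul, posS_inv, posS_of_ne] <;> try omega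
                exact hy' r h0 hr
              rw [mul_assoc]
              refine (h3.step hi hc).step hi fun r h0 hr => ?_
              rw [step_inv_smul_of_le y' hi h0 hr]
              exact hc r h0 hr
            · rw [← mul_assoc, lift_relations.stepProd_stepProd i hn]
      · refine key _ d z (j - 1) (by omega) h (by omega) (by omega)
          (fun y' hy' he => hy'.step hi fun r h0 hr => ?_) ?_
        · rw [he, mul_inv_rev, mul_smul, posS_inv, posS_of_ne] <;> try omega
          exact hz r h0 hr
        · rw [← mul_assoc, lift_relations.stepProd_of_gt i j (by omega) hn]

/-! ### Every positive element has a normal form -/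

theorem NF.one : NF 0 (1 : Lift n) := by
  refine NF.fin ?_
  have : ∀ k, k ≤ n → FinNF (n - k) (1 : Lift n) := by
    intro k
    induction k with
    | zero => intro _; exact FinNF.one
    | succ k ih =>
      intro hk
      have h1 := ih (by omega)
      rw [show n - k = n - (k + 1) + 1 by omega] at h1
      simpa [descProd] using h1.step (i := 0) (by omega)
  simpa using this n le_rfl

/-- Positivity of `σ` makes the preimage of `1` under `rot n * σ` nonpositive. This forces the first
index to be `0`, and `X_0 = b` can be cancelled. -/
theorem NF.of_b_mul [NeZero n] {d : ℕ} {z : Lift n} {σ : affPerm n} (h : NF d z)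
    (hσ : σ ∈ posAffPerm n) (he : z.2 = rot n * σ) : ∃ d' z', NF d' z' ∧ z'.2 = σ := by
  have h1 : z.2⁻¹ • (1 : ℤ) ≤ 0 := by
    have : (rot n)⁻¹ • (1 : ℤ) = 0 := by rw [inv_smul_eq_iff, smul_rot]; rfl
    rw [he, mul_inv_rev, mul_smul, this]
    by_contra hc
    have := hσ (σ⁻¹ • (0 : ℤ)) (by omega)
    change 0 < σ • σ⁻¹ • (0 : ℤ) at this
    rw [smul_inv_smul] at this
    omega
  cases h with
  | fin h => exact absurd (h.inv_mem 1 (by omega)) (not_lt.2 h1)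
  | @step d i z h hi hz =>
    obtain rfl : i = 0 := by
      by_contra h0
      rw [step_inv_smul_of_le z hi (by omega) (by omega)] at h1
      have := hz 1 (by omega) (by omega)
      omega
    refine ⟨d, z, h, ?_⟩
    have h2 : (stepProd (liftT n) (liftB n) 0 * z).2 = rot n * z.2 := by
      simp [stepProd, descProd, liftB]
    rw [h2] at he
    exact mul_left_cancel he

theorem rot_pow_mul_simple (k : ℕ) (a : Node n) :
    ∃ b : Node n, b.1 = a.1 + k ∧ rot n ^ k * simple a = simple b * rot n ^ k := by
  induction k with
  | zero => exact ⟨a, by simp, by simp⟩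
  | succ k ih =>
    obtain ⟨b, hb, h⟩ := ih
    refine ⟨b.succ, by simp [Node.succ, hb, add_assoc], ?_⟩
    rw [pow_succ', mul_assoc, h, ← mul_assoc, rot_mul_simple, mul_assoc]

/-- Normal forms can be multiplied on the left by `b` and `s_1, …, s_{n-1}` only; the power of `rot
n` absorbs negative exponents and the node `0`. -/
theorem exists_NF_rot_pow_mul [NeZero n] (d : ℤ) (w : List (Node n)) : ∃ (k e : ℕ) (z : Lift n),
    NF e z ∧ z.2 = rot n ^ k * ((w.map simple).prod * rot n ^ d) := by
  induction w with
  | nil =>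
    have hpow : ∀ k : ℕ, ∃ (e : ℕ) (z : Lift n), NF e z ∧ z.2 = rot n ^ k := by
      intro k
      induction k with
      | zero => exact ⟨0, 1, NF.one, by simp⟩
      | succ k ih =>
        obtain ⟨e, z, h, he⟩ := ih
        exact ⟨_, _, h.b_mul, by rw [Prod.snd_mul, he, pow_succ']; rfl⟩
    -- With `k = |d|` the total exponent `|d| + d` is nonnegative.
    obtain ⟨e, z, h, he⟩ := hpow (d.natAbs + d).toNat
    refine ⟨d.natAbs, e, z, h, ?_⟩
    rw [he, List.map_nil, List.prod_nil, one_mul, ← zpow_natCast, ← zpow_natCast, ← zpow_add]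
    congr 1
    omega
  | cons a w ih =>
    obtain ⟨k, e, z, h, he⟩ := ih
    have key : ∀ (k e : ℕ) (z : Lift n), NF e z →
        z.2 = rot n ^ k * ((w.map simple).prod * rot n ^ d) → a.1 + (k : ZMod n) ≠ 0 →
        ∃ (k e : ℕ) (z : Lift n),
          NF e z ∧ z.2 = rot n ^ k * (((a :: w).map simple).prod * rot n ^ d) := by
      intro k e z h he h0
      obtain ⟨b, hb, hk⟩ := rot_pow_mul_simple k a
      have hj1 : 1 ≤ b.1.val := by
        rw [Nat.one_le_iff_ne_zero, Ne, ZMod.val_eq_zero, hb]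
        exact h0
      have hj2 : b.1.val < n := ZMod.val_lt _
      obtain ⟨z', h1, h2, -⟩ := NF.exists_mul e z h b.1.val hj1 hj2
      refine ⟨k, e, z', h1, ?_⟩
      have hs : posS n b.1.val = simple b := by
        rw [posS_eq ⟨hj1, hj2⟩]
        congr 1
        apply Subtype.ext
        simp [FinNode.toNode]
      rw [h2, he, hs, List.map_cons, List.prod_cons, mul_assoc (simple a), ← mul_assoc (simple b),
        ← hk, mul_assoc]
    -- Past `rot n ^ k` the node `a` becomes `a + k`. If this is the missing node `0`, one more
    -- rotation turns it into `1`.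
    by_cases h0 : a.1 + (k : ZMod n) = 0
    · refine key (k + 1) (e + 1) (liftB n * z) h.b_mul ?_ ?_
      · rw [Prod.snd_mul, he, pow_succ', mul_assoc]; rfl
      · push_cast
        rw [← add_assoc, h0, zero_add]
        exact one_ne_zero_zmod a.2
    · exact key k e z h he h0

/-- A normal form exists after multiplication by some power of `rot n`; positivity of `σ` allows the
rotations to be stripped off one by one. -/
theorem exists_NF [NeZero n] {σ : affPerm n} (hσ : σ ∈ posAffPerm n) :
    ∃ d z, NF d z ∧ z.2 = σ := by
  obtain ⟨l, w, d, -, hw⟩ := exists_isExpr σ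
  obtain ⟨k, e, z, h, he⟩ := exists_NF_rot_pow_mul d w
  rw [← hw] at he
  induction k generalizing e z with
  | zero => exact ⟨e, z, h, by simpa using he⟩
  | succ k ih =>
    rw [pow_succ', mul_assoc] at he
    obtain ⟨e', z', h', he'⟩ := h.of_b_mul (mul_mem (pow_mem rot_mem k) hσ) he
    exact ih e' z' h' he'

end NF

/-! ### The homomorphism from the presented algebra -/

section Hom

variable {n : ℕ}

theorem T_sq (a : Node n) : T a * T a = 0 := by
  simpa [T, gen] using mk_rel (Rel.sq a)

theorem c_mul_T (a : Node n) : c n * T a = T a.succ * c n := by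
  simpa [T, c, gen] using mk_rel (Rel.c_T a)

theorem T_comm {a b : Node n} (h₁ : a.1 ≠ b.1 + 1) (h₂ : a.1 ≠ b.1 - 1) :
    T a * T b = T b * T a := by
  simpa [T, gen] using mk_rel (Rel.comm a b h₁ h₂)

theorem T_braid (h : 2 < n) (a : Node n) : T a * T a.succ * T a = T a.succ * T a * T a.succ := by
  simpa [T, gen] using mk_rel (Rel.braid a h)

/-- The images of the generators of the presented algebra. -/
def PosGen.toHhat : PosGen n → Hhat n
  | .t i => T i.toNode
  | .b => c n

/-- The homomorphism from the presented algebra to `Ĥ_n`. -/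
def posHom (n : ℕ) : PosAlg n →ₐ[ZMod 2] Hhat n :=
  RingQuot.liftAlgHom (ZMod 2) ⟨FreeAlgebra.lift (ZMod 2) PosGen.toHhat, by
    intro x y h
    cases h <;> simp only [map_mul, map_pow, map_zero, FreeAlgebra.lift_ι_apply, PosGen.toHhat]
    case sq i => exact T_sq _
    case comm i j h =>
      have h1 := toNode_far i.2 j.2 (by
        rw [lt_abs] at h
        omega)
      exact T_comm h1.1 h1.2
    case braid i j h =>
      obtain ⟨j, hj⟩ := j
      subst h
      have := i.2
      rw [show FinNode.toNode ⟨i.1 + 1, hj⟩ = i.toNode.succ from (toNode_succ i.2 hj).symm]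
      exact T_braid (by omega) _
    case b_t i j h =>
      obtain ⟨j, hj⟩ := j
      subst h
      rw [show FinNode.toNode ⟨i.1 + 1, hj⟩ = i.toNode.succ from (toNode_succ i.2 hj).symm]
      exact c_mul_T _
    case b_b_t i j hi hj =>
      obtain ⟨j, hj'⟩ := j
      obtain ⟨i, hi'⟩ := i
      simp only at hi hj
      subst hj
      obtain rfl : i = n - 1 := by omega
      rw [← toNode_succ_succ hi', sq, mul_assoc, c_mul_T, ← mul_assoc, c_mul_T, mul_assoc]⟩

theorem posHom_posGen (g : PosGen n) : posHom n (posGen g) = g.toHhat := by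
  simp [posHom, posGen, RingQuot.liftAlgHom_mkAlgHom_apply]

theorem posHom_b : posHom n (posGen PosGen.b) = c n := posHom_posGen _

theorem posHom_posT {j : ℕ} (h : 1 ≤ j ∧ j < n) :
    posHom n (posT n j) = T (FinNode.toNode ⟨j, h⟩) := by
  rw [posT_eq h, posHom_posGen]; rfl

theorem orbit_posT_mul {j : ℕ} (h : 1 ≤ j) (hj : j < n) {x : PosAlg n} {σ : affPerm n}
    (hx : orbit n (posHom n x) = Finsupp.single σ 1) (hσ : σ⁻¹ • (j : ℤ) < σ⁻¹ • ((j : ℤ) + 1)) :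
    orbit n (posHom n (posT n j * x)) = Finsupp.single (posS n j * σ) 1 := by
  rw [map_mul, posHom_posT ⟨h, hj⟩, posS_eq ⟨h, hj⟩]
  exact orbit_T_mul hx ((isAscent_iff (toNode_cast ⟨h, hj⟩)).2 hσ)

/-- Multiplication by a descending product of ascents. -/
theorem orbit_descProd_mul {m i : ℕ} (hi : m + i < n) {z : Lift n}
    (hz : orbit n (posHom n z.1) = Finsupp.single z.2 1)
    (h : ∀ r : ℤ, m + 1 < r → r ≤ m + i + 1 → z.2⁻¹ • ((m : ℤ) + 1) < z.2⁻¹ • r) :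
    orbit n (posHom n (descProd (liftT n) m i * z).1)
      = Finsupp.single (descProd (liftT n) m i * z).2 1 := by
  induction i with
  | zero => simpa [descProd] using hz
  | succ i ih =>
    rw [descProd, mul_assoc]
    refine orbit_posT_mul (by omega) (by omega)
      (ih (by omega) fun r h1 h2 => h r h1 (by push_cast; omega)) ?_
    have h1 : (descProd (posS n) m i)⁻¹ • ((m : ℤ) + i + 1) = m + 1 := by
      rw [inv_smul_eq_iff, descProd_smul_first _ _ (by omega)]
    have h2 : (descProd (posS n) m i)⁻¹ • ((m : ℤ) + i + 1 + 1) = m + i + 1 + 1 := by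
      rw [inv_smul_eq_iff, descProd_smul_of_gt _ _ (by omega) _ (by omega) (by omega)]
    push_cast
    rw [Prod.snd_mul, snd_descProd, mul_inv_rev, mul_smul, mul_smul, h1, h2]
    exact h _ (by omega) (by push_cast; omega)

/-- `z` fixes `1, …, m + 1`, so `z⁻¹` sends every larger integer `r` of the window above `m + 1`;
all letters of the new factor act at ascents. -/
theorem FinNF.orbit_eq {m : ℕ} {z : Lift n} (h : FinNF m z) :
    orbit n (posHom n z.1) = Finsupp.single z.2 1 := by
  induction h with
  | one => simp [orbit_one]
  | @step m i z h hi ih =>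
    refine orbit_descProd_mul hi ih fun r h1 h2 => ?_
    have h3 : z.2⁻¹ • ((m : ℤ) + 1) = m + 1 := by
      rw [inv_smul_eq_iff, h.smul_eq _ (by omega) (by push_cast; omega)]
    have h4 : 0 < z.2⁻¹ • r := h.inv_mem r (by omega)
    rw [h3]
    by_contra hc
    have h5 := h.smul_eq (z.2⁻¹ • r) h4 (by push_cast; omega)
    rw [smul_inv_smul] at h5
    omega

/-- After `b`, the letters of `X_i` compare `z⁻¹ • 0 ≤ 0` with the preimages of `1, …, i`, which the
side condition makes positive, so all act at ascents. -/
theorem NF.orbit_eq {d : ℕ} {z : Lift n} (h : NF d z) :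
    orbit n (posHom n z.1) = Finsupp.single z.2 1 := by
  induction h with
  | fin h => exact h.orbit_eq
  | @step d i z h hi hz ih =>
    rw [stepProd, mul_assoc]
    refine orbit_descProd_mul (by omega) ?_ fun r h1 h2 => ?_
    · rw [Prod.fst_mul, map_mul]
      change orbit n (posHom n (posGen PosGen.b) * _) = Finsupp.single (rot n * _) 1
      rw [posHom_b]
      exact orbit_c_mul ih
    · have hr : ∀ r : ℤ, (liftB n * z).2⁻¹ • r = z.2⁻¹ • (r - 1) := fun r => by
        have : (rot n)⁻¹ • r = r - 1 := by rw [inv_smul_eq_iff, smul_rot]; ring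
        rw [Prod.snd_mul, mul_inv_rev, mul_smul]
        exact congrArg _ this
      rw [hr, hr]
      have h3 := h.inv_smul_zero
      have h4 := hz (r - 1) (by push_cast at h1; omega) (by push_cast at h2; omega)
      simpa using h3.trans_lt h4

/-! ### Normal forms span, and `posHom` is injective -/

/-- The monomials in the generators span the presented algebra. -/
theorem span_monomials_posAlg :
    Submodule.span (ZMod 2) {x : PosAlg n | ∃ w : List (PosGen n), x = (w.map posGen).prod}
      = ⊤ := by
  rw [eq_top_iff]
  rintro x -
  obtain ⟨y, rfl⟩ := RingQuot.mkAlgHom_surjective (ZMod 2) (PosRel n) x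
  induction y using FreeAlgebra.induction with
  | grade0 r =>
    rw [AlgHom.commutes, Algebra.algebraMap_eq_smul_one]
    exact Submodule.smul_mem _ _ (Submodule.subset_span ⟨[], by simp⟩)
  | grade1 g => exact Submodule.subset_span ⟨[g], by simp [posGen]⟩
  | mul x y hx hy =>
    rw [map_mul]
    have h := Submodule.mul_mem_mul hx hy
    rw [Submodule.span_mul_span] at h
    refine Submodule.span_mono ?_ h
    rintro _ ⟨_, ⟨w, rfl⟩, _, ⟨v, rfl⟩, rfl⟩
    exact ⟨w ++ v, by simp⟩
  | add x y hx hy => rw [map_add]; exact add_mem hx hy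

theorem monomial_eq_zero_or_NF [NeZero n] (w : List (PosGen n)) :
    (w.map posGen).prod = 0 ∨ ∃ (d : ℕ) (z : Lift n), NF d z ∧ z.1 = (w.map posGen).prod := by
  induction w with
  | nil => exact Or.inr ⟨0, 1, NF.one, rfl⟩
  | cons g w ih =>
    rw [List.map_cons, List.prod_cons]
    rcases ih with h | ⟨d, z, h, he⟩
    · left; rw [h, mul_zero]
    · rw [← he]
      cases g with
      | b => exact Or.inr ⟨_, _, h.b_mul, rfl⟩
      | t i =>
        obtain ⟨z', h1, -, h3⟩ := NF.exists_mul d z h i.1 i.2.1 i.2.2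
        rw [show posGen (PosGen.t i) = posT n i.1 from (posT_eq i.2).symm]
        rcases h3 with h3 | h3
        · exact Or.inr ⟨d, z', h1, by rw [← h3]; rfl⟩
        · exact Or.inl h3

theorem span_NF [NeZero n] :
    Submodule.span (ZMod 2) {x : PosAlg n | ∃ (d : ℕ) (z : Lift n), NF d z ∧ z.1 = x} = ⊤ := by
  rw [eq_top_iff, ← span_monomials_posAlg, Submodule.span_le]
  rintro _ ⟨w, rfl⟩
  rcases monomial_eq_zero_or_NF w with h | h
  · rw [h]; exact zero_mem _
  · exact Submodule.subset_span h

open Classical in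
/-- The normal form over a group element. -/
noncomputable def normalForm (σ : affPerm n) : PosAlg n :=
  if h : ∃ (d : ℕ) (z : Lift n), NF d z ∧ z.2 = σ then h.choose_spec.choose.1 else 0

theorem NF.normalForm_eq {d : ℕ} {z : Lift n} (h : NF d z) : normalForm z.2 = z.1 := by
  have hex : ∃ (d' : ℕ) (z' : Lift n), NF d' z' ∧ z'.2 = z.2 := ⟨d, z, h, rfl⟩
  rw [normalForm, dif_pos hex]
  obtain ⟨h1, h2⟩ := hex.choose_spec.choose_spec
  rw [h1.unique _ _ h h2]

/-- Sending each basis vector to its normal form is a left inverse, as is checked on the spanning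
set of normal forms. -/
theorem orbit_posHom_injective [NeZero n] :
    Function.Injective fun x : PosAlg n => orbit n (posHom n x) := by
  let ψ : GroupSpace n →ₗ[ZMod 2] PosAlg n := Finsupp.linearCombination (ZMod 2) normalForm
  have h : (ψ ∘ₗ orbit n ∘ₗ (posHom n).toLinearMap) = LinearMap.id := by
    apply LinearMap.ext_on span_NF
    rintro _ ⟨d, z, hz, rfl⟩
    simp only [LinearMap.comp_apply, AlgHom.toLinearMap_apply, LinearMap.id_apply]
    rw [hz.orbit_eq]
    simp [ψ, hz.normalForm_eq]
  exact Function.LeftInverse.injective (g := ψ) fun x => LinearMap.congr_fun h x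

theorem posHom_injective [NeZero n] : Function.Injective (posHom n) := fun _ _ h =>
  orbit_posHom_injective (congrArg (orbit n) h)

/-! ### The orbit map is injective -/

theorem c_pow_mul_T (k : ℕ) (a : Node n) : c n ^ k * T a = T (Node.succ^[k] a) * c n ^ k := by
  induction k with
  | zero => simp
  | succ k ih =>
    rw [pow_succ', mul_assoc, ih, ← mul_assoc, c_mul_T, Function.iterate_succ_apply', mul_assoc]

theorem succ_iterate (k : ℕ) (a : Node n) : (Node.succ^[k] a).1 = a.1 + k := by
  induction k with
  | zero => simp
  | succ k ih =>
    rw [Function.iterate_succ_apply', Node.succ, ih]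
    push_cast
    ring

theorem c_pow_commute_gen (g : Gen n) : Commute (c n ^ n) (gen g) := by
  cases g with
  | T a =>
    have h : Node.succ^[n] a = a := Subtype.ext (by rw [succ_iterate]; simp)
    change c n ^ n * T a = T a * c n ^ n
    rw [c_pow_mul_T, h]
  | c => exact (Commute.refl (c n)).pow_left n
  | cinv =>
    have h : Commute (c n) (gen Gen.cinv) := (cUnit n).mul_inv.trans (cUnit n).inv_mul.symm
    exact h.pow_left n

/-- The generators outside the image are `T_0` and `c⁻¹`. One factor `c` repairs each: `c T_0 = T_1
c` and `c c⁻¹ = 1`. -/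
theorem c_pow_mul_gen_mem [NeZero n] (g : Gen n) : c n ^ n * gen g ∈ (posHom n).range := by
  have hc : c n ∈ (posHom n).range := ⟨_, posHom_b⟩
  have hT : ∀ a : Node n, a.1 ≠ 0 → T a ∈ (posHom n).range := by
    intro a ha
    have hj : 1 ≤ a.1.val ∧ a.1.val < n := by
      refine ⟨?_, ZMod.val_lt _⟩
      rw [Nat.one_le_iff_ne_zero, Ne, ZMod.val_eq_zero]
      exact ha
    refine ⟨posT n a.1.val, (posHom_posT hj).trans ?_⟩
    congr 1
    apply Subtype.ext
    simp [FinNode.toNode]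
  have hn : c n ^ n = c n ^ (n - 1) * c n := by
    rw [← pow_succ, Nat.sub_add_cancel (NeZero.pos n)]
  cases g with
  | T a =>
    change c n ^ n * T a ∈ _
    by_cases ha : a.1 = 0
    · rw [hn, mul_assoc, c_mul_T]
      refine mul_mem (pow_mem hc _) (mul_mem (hT _ ?_) hc)
      simpa [Node.succ, ha] using one_ne_zero_zmod a.2
    · exact mul_mem (pow_mem hc _) (hT a ha)
  | c => exact mul_mem (pow_mem hc _) hc
  | cinv =>
    rw [hn, mul_assoc, show c n * gen Gen.cinv = 1 from (cUnit n).mul_inv, mul_one]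
    exact pow_mem hc _

theorem exists_c_pow_mul_mem [NeZero n] (x : Hhat n) :
    ∃ k : ℕ, (c n ^ n) ^ k * x ∈ (posHom n).range := by
  have hb : c n ∈ (posHom n).range := ⟨_, posHom_b⟩
  have hc : c n ^ n ∈ (posHom n).range := pow_mem hb _
  induction mem_span_monomials x using Submodule.span_induction with
  | mem x h =>
    obtain ⟨w, rfl⟩ := h
    induction w with
    | nil => exact ⟨0, by simp⟩
    | cons g w ih =>
      obtain ⟨k, hk⟩ := ih
      refine ⟨k + 1, ?_⟩
      have := mul_mem (c_pow_mul_gen_mem g) hk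
      rw [mul_assoc, ← mul_assoc (gen g), ← ((c_pow_commute_gen g).pow_left k).eq] at this
      rw [pow_succ', mul_assoc, List.map_cons, List.prod_cons]
      rwa [mul_assoc] at this
  | zero => exact ⟨0, by simp⟩
  | add x y _ _ h1 h2 =>
    obtain ⟨k, hk⟩ := h1
    obtain ⟨l, hl⟩ := h2
    refine ⟨k + l, ?_⟩
    rw [mul_add]
    refine add_mem ?_ ?_
    · rw [add_comm, pow_add, mul_assoc]; exact mul_mem (pow_mem hc _) hk
    · rw [pow_add, mul_assoc]; exact mul_mem (pow_mem hc _) hl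
  | smul a x _ h =>
    obtain ⟨k, hk⟩ := h
    exact ⟨k, by rw [mul_smul_comm]; exact Subalgebra.smul_mem _ hk a⟩

/-- A power of `c^n` moves a kernel element into the image of `posHom`, where `orbit` is injective;
`c` is a unit, so the element was zero. -/
theorem orbit_injective [NeZero n] : Function.Injective (orbit n) := by
  rw [injective_iff_map_eq_zero]
  intro x hx
  obtain ⟨k, y, hy⟩ := exists_c_pow_mul_mem x
  have hy' : posHom n y = (c n ^ n) ^ k * x := hy
  have h0 : orbit n (posHom n y) = orbit n (posHom n 0) := by
    rw [hy', orbit_mul, hx, map_zero, map_zero, map_zero]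
  rw [orbit_posHom_injective h0, map_zero] at hy'
  have hu : IsUnit ((c n ^ n) ^ k) := (((cUnit n).isUnit : IsUnit (c n)).pow n).pow k
  exact (hu.mul_right_eq_zero).1 hy'.symm

/-! ### The image of the presented algebra -/

theorem NF.posHom_eq_Tel [NeZero n] {d : ℕ} {z : Lift n} (h : NF d z) :
    posHom n z.1 = Tel z.2 :=
  orbit_injective (by rw [h.orbit_eq, orbit_Tel])

theorem toSubmodule_range_posHom [NeZero n] :
    Subalgebra.toSubmodule (posHom n).range = HhatPlus n := by
  apply le_antisymm
  · rintro _ ⟨x, rfl⟩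
    change posHom n x ∈ HhatPlus n
    have hx : x ∈ Submodule.span (ZMod 2)
        {x : PosAlg n | ∃ (d : ℕ) (z : Lift n), NF d z ∧ z.1 = x} := by
      rw [span_NF]; trivial
    induction hx using Submodule.span_induction with
    | mem x h =>
      obtain ⟨d, z, h, rfl⟩ := h
      rw [h.posHom_eq_Tel]
      exact Submodule.subset_span ⟨z.2, h.mem, rfl⟩
    | zero => rw [map_zero]; exact zero_mem _
    | add x y _ _ h1 h2 => rw [map_add]; exact add_mem h1 h2
    | smul a x _ h => rw [map_smul]; exact Submodule.smul_mem _ _ h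
  · refine Submodule.span_le.2 ?_
    rintro _ ⟨σ, hσ, rfl⟩
    obtain ⟨d, z, h, rfl⟩ := exists_NF hσ
    exact ⟨z.1, h.posHom_eq_Tel⟩

/-! ### The image is a differential graded subalgebra -/

theorem monomial_mem_range (w : List (PosGen n)) :
    (w.map PosGen.toHhat).prod ∈ (posHom n).range := by
  refine Subalgebra.list_prod_mem _ fun x hx => ?_
  obtain ⟨g, -, rfl⟩ := List.mem_map.1 hx
  exact ⟨_, posHom_posGen g⟩

theorem isDGSubalgebra_range_posHom : IsDGSubalgebra (dgStructure n) (posHom n).range := by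
  have hspan : ∀ x ∈ (posHom n).range, x ∈ Submodule.span (ZMod 2)
      {x : Hhat n | ∃ w : List (PosGen n), x = (w.map PosGen.toHhat).prod} := by
    rintro _ ⟨y, rfl⟩
    have hy : y ∈ Submodule.span (ZMod 2)
        {x : PosAlg n | ∃ w : List (PosGen n), x = (w.map posGen).prod} := by
      rw [span_monomials_posAlg]; trivial
    have h := Submodule.mem_map_of_mem (f := (posHom n).toLinearMap) hy
    rw [Submodule.map_span] at h
    refine Submodule.span_mono ?_ h
    rintro _ ⟨_, ⟨w, rfl⟩, rfl⟩
    refine ⟨w, ?_⟩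
    rw [AlgHom.toLinearMap_apply, map_list_prod, List.map_map]
    congr 2
    funext g
    exact posHom_posGen g
  constructor
  · intro x hx k
    change (DirectSum.decompose (piece n) x k : Hhat n) ∈ _
    have hx' := hspan x hx
    clear hx
    induction hx' using Submodule.span_induction with
    | mem x h =>
      obtain ⟨w, rfl⟩ := h
      -- Monomials in the generators are homogeneous, so each component is the monomial itself or
      -- zero.
      have hw : ∃ d, (w.map PosGen.toHhat).prod ∈ piece n d := by
        induction w with
        | nil => exact ⟨0, SetLike.one_mem_graded _⟩
        | cons g w ih =>
          obtain ⟨d, hd⟩ := ih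
          cases g with
          | t i => exact ⟨_, SetLike.mul_mem_graded (gen_mem (Gen.T i.toNode)) hd⟩
          | b => exact ⟨_, SetLike.mul_mem_graded (gen_mem Gen.c) hd⟩
      obtain ⟨d, hd⟩ := hw
      by_cases hk : d = k
      · subst hk
        rw [DirectSum.decompose_of_mem_same _ hd]
        exact monomial_mem_range w
      · rw [DirectSum.decompose_of_mem_ne _ hd hk]
        exact zero_mem _
    | zero => simp
    | add x y _ _ h1 h2 =>
      rw [DirectSum.decompose_add, DirectSum.add_apply]
      exact add_mem h1 h2
    | smul a x _ h =>
      rw [DirectSum.decompose_smul]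
      exact Subalgebra.smul_mem _ h a
  · intro x hx
    change diff n x ∈ _
    have hx' := hspan x hx
    clear hx
    induction hx' using Submodule.span_induction with
    | mem x h =>
      obtain ⟨w, rfl⟩ := h
      induction w with
      | nil => simp [diff_one]
      | cons g w ih =>
        rw [List.map_cons, List.prod_cons, diff_mul]
        refine add_mem (mul_mem ?_ (monomial_mem_range w)) (mul_mem ⟨_, posHom_posGen g⟩ ih)
        cases g with
        | t i => rw [PosGen.toHhat, diff_T]; exact one_mem _
        | b => rw [PosGen.toHhat, diff_c]; exact zero_mem _
    | zero => simp
    | add x y _ _ h1 h2 => rw [map_add]; exact add_mem h1 h2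
    | smul a x _ h => rw [map_smul]; exact Subalgebra.smul_mem _ h a

end Hom

end ExtAffine
theorem mainTheorem7 (n : ℕ) [NeZero n] :
    ∃ S : Subalgebra (ZMod 2) (ExtAffine.Hhat n),
      Subalgebra.toSubmodule S = ExtAffine.HhatPlus n ∧
      ExtAffine.IsDGSubalgebra (ExtAffine.dgStructure n) S ∧
      ∃ e : ExtAffine.PosAlg n ≃ₐ[ZMod 2] S,
        (∀ i : ExtAffine.FinNode n,
          (e (ExtAffine.posGen (ExtAffine.PosGen.t i)) : ExtAffine.Hhat n)
            = ExtAffine.T i.toNode) ∧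
        (e (ExtAffine.posGen ExtAffine.PosGen.b) : ExtAffine.Hhat n) = ExtAffine.c n := by
  refine ⟨(ExtAffine.posHom n).range, ExtAffine.toSubmodule_range_posHom,
    ExtAffine.isDGSubalgebra_range_posHom,
    AlgEquiv.ofInjective (ExtAffine.posHom n) ExtAffine.posHom_injective, fun i => ?_, ?_⟩
  · exact ExtAffine.posHom_posGen _
  · exact ExtAffine.posHom_posGen _
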